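/- Let $M$ be a smooth manifold of dimension $2n+1$, $n\ge 1$, with a contact sub-Riemannian structure $(\Delta,g)$: $\Delta\subset TM$ is a smooth distribution of rank $2n$ which is locally the kernel of a smooth 1-form $\omega$ with $\omega\wedge(d\omega)^n$ nowhere zero, and $g$ is a smooth inner product on $\Delta$. Let $$H(p,q)=\frac12\sup_{v\in\Delta_q\setminus\{0\}}\frac{\langle p,v\rangle^2}{g_q(v,v)},\qquad q\in M,\ p\in T_q^*M,$$ be the sub-Riemannian Hamiltonian, $\vec H$ its Hamiltonian vector field on $T^*M$ and $\pi:T^*M\to M$ the projection. For $q_0\in M$ let $\mathcal E_{q_0}(t,p)=\pi\circ e^{t\vec H}(p,q_0)$ be the sub-Riemannian exponential, defined for those $t\ge 0$ and $p\in T_{q_0}^*M$ for which the integral curve of $\vec H$ issued from $(p,q_0)$ exists on $[0,t]$. A conjugate time for $p$ is a time $t>0$ such that $\mathcal E_{q_0}(t,\cdot)$ is defined at $p$ and critical at $p$ (its differential at $p$ is not onto); $t_c(p)\in[0,+\infty]$ denotes the first conjugate time, that is, the infimum of the conjugate times for $p$. Fix $q_0\in M$ and a vector $X_0\in T_{q_0}M\setminus\Delta_{q_0}$,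 and set $h_0(p)=\langle p,X_0\rangle$ for $p\in T^*_{q_0}M$. Then: (a) for every $\bar h_0>0$ there is $\varepsilon>0$ such that every $p\in T^*_{q_0}M$ with $H(p,q_0)=\frac12$ and $t_c(p)<\varepsilon$ satisfies $|h_0(p)|>\bar h_0$; (b) for every $\alpha>0$ there is $R>0$ such that every critical point $p$ of $\mathcal E_{q_0}(1,\cdot)$ with $0<H(p,q_0)<R$ satisfies $h_0(p)^2>\alpha\,H(p,q_0)$. -/

import Mathlib

open Set Topology
open scoped Manifold ContDiff

/-- The model space `ℝ^(2n+1)` of a contact manifold of dimension `2n+1`. -/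
abbrev ContactModel (n : ℕ) : Type := EuclideanSpace ℝ (Fin (2 * n + 1))

section Covectors

variable {n : ℕ} {M : Type*} [TopologicalSpace M] [ChartedSpace (ContactModel n) M]

/-- The cotangent space `T*_q M`. -/
abbrev CotSpace (n : ℕ) {M : Type*} [TopologicalSpace M] [ChartedSpace (ContactModel n) M]
    (q : M) : Type :=
  TangentSpace (𝓡 (2 * n + 1)) q →L[ℝ] ℝ

/-- The cotangent bundle `T*M`, as the set of pairs (point, covector at this point). -/
abbrev CotBundle (n : ℕ) (M : Type*) [TopologicalSpace M] [ChartedSpace (ContactModel n) M] :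
    Type _ :=
  Bundle.TotalSpace (ContactModel n →L[ℝ] ℝ) (fun q : M => CotSpace n q)

/-- The momentum coordinates of a covector `p ∈ T*_q M` in the chart `φ` of `M` around `c`:
the covector `p ∘ D(φ⁻¹)(φ q)` on `ℝ^(2n+1)`. -/
noncomputable def covectorInChart (c q : M) (p : CotSpace n q) : ContactModel n →L[ℝ] ℝ :=
  let φ := extChartAt (𝓡 (2 * n + 1)) c
  ContinuousLinearMap.comp (show ContactModel n →L[ℝ] ℝ from p)
    (mfderiv 𝓘(ℝ, ContactModel n) (𝓡 (2 * n + 1)) φ.symm (φ q))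

/-- The covector at the point `φ⁻¹ x` whose momentum coordinates in the chart `φ` around `c`
are `ξ`: the covector `ξ ∘ Dφ(φ⁻¹ x)`. -/
noncomputable def covectorOfChart (c : M) (x : ContactModel n) (ξ : ContactModel n →L[ℝ] ℝ) :
    CotSpace n ((extChartAt (𝓡 (2 * n + 1)) c).symm x) :=
  let φ := extChartAt (𝓡 (2 * n + 1)) c
  ContinuousLinearMap.comp ξ
    (mfderiv (𝓡 (2 * n + 1)) 𝓘(ℝ, ContactModel n) φ (φ.symm x))

/-- The expression `x ↦ θ(φ⁻¹ x) ∘ D(φ⁻¹)(x)` of a 1-form `θ` in the chart `φ` around `c`. -/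
noncomputable def oneFormInChart (θ : ∀ q : M, CotSpace n q) (c : M) (x : ContactModel n) :
    ContactModel n →L[ℝ] ℝ :=
  let φ := extChartAt (𝓡 (2 * n + 1)) c
  ContinuousLinearMap.comp (show ContactModel n →L[ℝ] ℝ from θ (φ.symm x))
    (mfderiv 𝓘(ℝ, ContactModel n) (𝓡 (2 * n + 1)) φ.symm x)

/-- The 1-form `θ` is smooth on the set `U`: it is so in charts. -/
def SmoothOneFormOn (θ : ∀ q : M, CotSpace n q) (U : Set M) : Prop :=
  ∀ c : M, ContDiffOn ℝ ∞ (oneFormInChart θ c)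
    ((extChartAt (𝓡 (2 * n + 1)) c).target ∩ (extChartAt (𝓡 (2 * n + 1)) c).symm ⁻¹' U)

end Covectors

/-- The exterior derivative `dα(u, v) = (D_u α)(v) - (D_v α)(u)` at `x` of a 1-form `α` on
a normed space. -/
noncomputable def dOneForm {E : Type*} [NormedAddCommGroup E] [NormedSpace ℝ E]
    (α : E → E →L[ℝ] ℝ) (x u v : E) : ℝ :=
  fderiv ℝ α x u v - fderiv ℝ α x v u

/-- The value of the alternating form `a ∧ b^n` on `2n+1` vectors, up to a positive factor which
depends only on `n`, for a linear form `a` and an alternating bilinear form `b`. -/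
noncomputable def wedgePow {E : Type*} (n : ℕ) (a : E → ℝ) (b : E → E → ℝ)
    (v : Fin (2 * n + 1) → E) : ℝ :=
  ∑ σ : Equiv.Perm (Fin (2 * n + 1)), ((Equiv.Perm.sign σ : ℤ) : ℝ) *
    (a (v (σ 0)) *
      ∏ i : Fin n, b (v (σ ⟨2 * (i : ℕ) + 1, by omega⟩)) (v (σ ⟨2 * (i : ℕ) + 2, by omega⟩)))

/-- `θ ∧ (dθ)^n` is nonzero at the point `q`. -/
def IsContactFormAt {n : ℕ} {M : Type*} [TopologicalSpace M] [ChartedSpace (ContactModel n) M]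
    (θ : ∀ q : M, CotSpace n q) (q : M) : Prop :=
  let x : ContactModel n := extChartAt (𝓡 (2 * n + 1)) q q
  let α : ContactModel n → ContactModel n →L[ℝ] ℝ := oneFormInChart θ q
  ∃ v : Fin (2 * n + 1) → ContactModel n, wedgePow n (α x) (dOneForm α x) v ≠ 0

/-- A contact sub-Riemannian structure `(Δ, g)` on a manifold `M` of dimension `2n+1`: a smooth
distribution `Δ` of rank `2n` with a smoothly varying inner product `g` on it, such that `Δ` is
locally the kernel of a smooth 1-form `θ` with `θ ∧ (dθ)^n` nowhere zero. -/
structure ContactSubRiemannian (n : ℕ) (M : Type*) [TopologicalSpace M]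
    [ChartedSpace (ContactModel n) M] [IsManifold (𝓡 (2 * n + 1)) ∞ M] where
  /-- the distribution -/
  Δ : ∀ q : M, Submodule ℝ (TangentSpace (𝓡 (2 * n + 1)) q)
  /-- the metric on the distribution -/
  g : ∀ q : M, LinearMap.BilinForm ℝ (Δ q)
  g_symm : ∀ (q : M) (v w : Δ q), g q v w = g q w v
  g_pos : ∀ (q : M) (v : Δ q), v ≠ 0 → 0 < g q v v
  /-- `Δ` and `g` are smooth: near every point there is a smooth frame of `Δ` in which the
  coefficients of `g` are smooth functions. -/
  smooth : ∀ q₀ : M, ∃ U : Set M, IsOpen U ∧ q₀ ∈ U ∧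
    ∃ Y : Fin (2 * n) → ∀ q : M, Δ q,
      (∀ i, ContMDiffOn (𝓡 (2 * n + 1)) (𝓡 (2 * n + 1)).tangent ∞
        (fun q : M => (⟨q, (Y i q : TangentSpace (𝓡 (2 * n + 1)) q)⟩ :
          TangentBundle (𝓡 (2 * n + 1)) M)) U) ∧
      (∀ q ∈ U, LinearIndependent ℝ (fun i => Y i q) ∧
        Submodule.span ℝ (range fun i => Y i q) = ⊤) ∧
      (∀ i j, ContMDiffOn (𝓡 (2 * n + 1)) 𝓘(ℝ, ℝ) ∞ (fun q : M => g q (Y i q) (Y j q)) U)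
  /-- `Δ` is a contact distribution. -/
  contact : ∀ q₀ : M, ∃ U : Set M, IsOpen U ∧ q₀ ∈ U ∧
    ∃ θ : ∀ q : M, CotSpace n q, SmoothOneFormOn θ U ∧
      ∀ q ∈ U, (∀ v, v ∈ Δ q ↔ θ q v = 0) ∧ IsContactFormAt θ q

namespace ContactSubRiemannian

variable {n : ℕ} {M : Type*} [TopologicalSpace M] [ChartedSpace (ContactModel n) M]
  [IsManifold (𝓡 (2 * n + 1)) ∞ M]

/-- The sub-Riemannian Hamiltonian
`H(p, q) = 1/2 * sup_{v ∈ Δ_q, v ≠ 0} ⟨p, v⟩² / g_q(v, v)`. -/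
noncomputable def hamiltonian (S : ContactSubRiemannian n M) (q : M) (p : CotSpace n q) : ℝ :=
  1 / 2 * ⨆ v : {v : S.Δ q // v ≠ 0}, p (v : S.Δ q) ^ 2 / S.g q v v

/-- The Hamiltonian in the canonical coordinates `(x, ξ)` of `T*M` given by the chart of `M`
around `c`. -/
noncomputable def hamiltonianInChart (S : ContactSubRiemannian n M) (c : M)
    (x : ContactModel n) (ξ : ContactModel n →L[ℝ] ℝ) : ℝ :=
  S.hamiltonian ((extChartAt (𝓡 (2 * n + 1)) c).symm x) (covectorOfChart c x ξ)

/-- The curve `z` in `T*M` is a normal extremal on `[0, T]`, that is, an integral curve of the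
Hamiltonian vector field of `H`: its projection to `M` is continuous, and Hamilton's equations
`x' = ∂H/∂ξ`, `ξ' = -∂H/∂x` hold in the canonical coordinates `(x, ξ)` of every chart, at each
time at which the curve is in the domain of this chart. (The first equation is tested on all
linear forms `a` and the second one on all vectors `u`.) -/
def IsNormalExtremal (S : ContactSubRiemannian n M) (T : ℝ) (z : ℝ → CotBundle n M) : Prop :=
  ContinuousOn (fun t => (z t).proj) (Icc 0 T) ∧
  ∀ c : M, ∀ t ∈ Icc 0 T, (z t).proj ∈ (extChartAt (𝓡 (2 * n + 1)) c).source →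
    let x : ℝ → ContactModel n := fun s => extChartAt (𝓡 (2 * n + 1)) c (z s).proj
    let ξ : ℝ → ContactModel n →L[ℝ] ℝ := fun s => covectorInChart c (z s).proj (z s).snd
    (∀ a : ContactModel n →L[ℝ] ℝ, HasDerivWithinAt (fun s => a (x s))
      (fderiv ℝ (fun η => S.hamiltonianInChart c (x t) η) (ξ t) a) (Icc 0 T) t) ∧
    (∀ u : ContactModel n, HasDerivWithinAt (fun s => ξ s u)
      (-(fderiv ℝ (fun y => S.hamiltonianInChart c y (ξ t)) (x t) u)) (Icc 0 T) t)

/-- The covectors `p` at `q` such that the normal extremal issued from `(q, p)` exists on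
`[0, t]`: the domain of the sub-Riemannian exponential at `q` at time `t`. -/
def expDomain (S : ContactSubRiemannian n M) (q : M) (t : ℝ) : Set (CotSpace n q) :=
  {p | ∃ z : ℝ → CotBundle n M, z 0 = ⟨q, p⟩ ∧ S.IsNormalExtremal t z}

open Classical in
/-- The sub-Riemannian exponential `𝓔_q(t, p)`: the projection to `M` of the point reached at
time `t` by the normal extremal issued from `(q, p)`. Outside its domain its value is
irrelevant (we take `q`). -/
noncomputable def exp (S : ContactSubRiemannian n M) (q : M) (t : ℝ) (p : CotSpace n q) : M :=
  if h : p ∈ S.expDomain q t then (h.choose t).proj else q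

/-- `p` is a critical (singular) point of the exponential at time `t`, i.e. of the map
`𝓔_q(t, ·)` from (its domain in) `T*_q M` to `M`: its differential at `p` is not onto. -/
def IsCriticalPoint (S : ContactSubRiemannian n M) (q : M) (t : ℝ) (p : CotSpace n q) : Prop :=
  p ∈ S.expDomain q t ∧
    ¬ Function.Surjective (mfderiv 𝓘(ℝ, ContactModel n →L[ℝ] ℝ) (𝓡 (2 * n + 1))
      (fun p' : ContactModel n →L[ℝ] ℝ => S.exp q t p') p)

/-- `t` is a conjugate time for `p`. -/
def IsConjugateTime (S : ContactSubRiemannian n M) (q : M) (p : CotSpace n q) (t : ℝ) : Prop :=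
  0 < t ∧ S.IsCriticalPoint q t p

/-- The first conjugate time `t_c(p)` of `p` (`+∞` if `p` has no conjugate time). -/
noncomputable def firstConjugateTime (S : ContactSubRiemannian n M) (q : M) (p : CotSpace n q) :
    EReal :=
  sInf ((fun t : ℝ => (t : EReal)) '' {t | S.IsConjugateTime q p t})

end ContactSubRiemannian

/-! Both claims follow from one: for every b there is ε > 0 such that, for 0 < t < ε, no covector p
with H(p) = 1/2 and |h₀(p)| ≤ b is critical for the exponential at time t, and t • p is not critical
for the exponential at time 1 (`exists_forall_not_isCriticalPoint`). Claim (a) is the case b = h̄₀.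
For (b), H is quadratic on the fibres, so the time-one exponential at t • p is the time-t
exponential at p. A covector with H = s²/2 is s times a point of the cylinder H = 1/2, and h₀² ≤ αH
bounds the vertical component of that point by √(α/2).

This part of the cylinder is compact, because H controls a covector on Δ and h₀ controls it in the
remaining direction. Hence it suffices to find ε on a neighbourhood of each p₀ with H(p₀) ≠ 0. In a
chart H = ½ ξ(B(x)ξ), where B is smooth, symmetric and nonnegative and its kernel is spanned by the
contact form θ. If the differential of the exponential is not onto, then by equality of dimensions
there is a Jacobi field (y, η) with η(0) ≠ 0 whose position part y vanishes at 0 and at t. Two steps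
exclude this for short times.

`jacobi_fst_eq_zero`: y vanishes identically. The derivative of η(y) is η(Bη) plus a term quadratic
in y, and η(y) vanishes at both ends. So the integral of η(Bη) is O(t max|y|²), which by
Cauchy-Schwarz controls Bη and bounds max|y| by a quantity smaller than itself.

`jacobi_snd_eq_zero`: η(0) = 0. Now Bη = 0 along the extremal, so η is a multiple fθ. The derivative
at time 0 gives f(0) dθ(v, u) = 0 for all u in ker θ, v being the initial velocity. As H ≠ 0, v is
nonzero, and the contact condition forces f(0) = 0.

The transfer to the manifold rests on the invariance of Hamilton's equations
(`hamilton_change_coordinates`), by which a solution in one chart is an extremal in all charts, and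
on uniqueness of extremals (`IsNormalExtremal.proj_eq`), by which the exponential is the one
computed in the chart. -/

set_option maxSynthPendingDepth 3

/-! ### Differentiability of a flow in its initial point -/

section Flow

variable {V : Type*} [NormedAddCommGroup V] [NormedSpace ℝ V]

/-- The vector field of the variational equation `z' = F z`, `A' = DF(z) ∘ A`. -/
noncomputable def variationalField (F : V → V) (w : V × (V →L[ℝ] V)) : V × (V →L[ℝ] V) :=
  (F w.1, (fderiv ℝ F w.1).comp w.2)

theorem contDiffAt_variationalField {F : V → V} {z₀ : V} {A : V →L[ℝ] V}
    (hF : ContDiffAt ℝ 2 F z₀) : ContDiffAt ℝ 1 (variationalField F) (z₀, A) := by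
  have h1 : ContDiffAt ℝ 1 (fderiv ℝ F) z₀ := hF.fderiv_right (by norm_num)
  refine ContDiffAt.prodMk ?_ ?_
  · exact (hF.of_le (by norm_num)).comp (z₀, A) contDiffAt_fst
  · exact ContDiffAt.clm_comp (h1.comp (z₀, A) contDiffAt_fst) contDiffAt_snd

/-- A map with Lipschitz derivative is approximated by its derivative up to quadratic order. -/
theorem norm_sub_sub_fderiv_le {F : V → V} {z₀ : V} {ρ : ℝ} {K : NNReal}
    (hd : ∀ z ∈ Metric.ball z₀ ρ, DifferentiableAt ℝ F z)
    (hK : LipschitzOnWith K (fderiv ℝ F) (Metric.ball z₀ ρ)) {a b : V}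
    (ha : a ∈ Metric.ball z₀ ρ) (hb : b ∈ Metric.ball z₀ ρ) :
    ‖F b - F a - fderiv ℝ F a (b - a)‖ ≤ K * ‖b - a‖ ^ 2 := by
  have hseg : segment ℝ a b ⊆ Metric.ball z₀ ρ := (convex_ball z₀ ρ).segment_subset ha hb
  have := Convex.norm_image_sub_le_of_norm_hasFDerivWithin_le' (f := F) (f' := fderiv ℝ F)
    (φ := fderiv ℝ F a) (C := K * ‖b - a‖) (s := segment ℝ a b) (x := a) (y := b)
    (fun x hx => (hd x (hseg hx)).hasFDerivAt.hasFDerivWithinAt)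
    (fun x hx => by
      refine (hK.norm_sub_le (hseg hx) ha).trans ?_
      gcongr
      exact norm_sub_le_of_mem_segment hx)
    (convex_segment a b) (left_mem_segment ℝ a b) (right_mem_segment ℝ a b)
  calc _ ≤ _ := this
    _ = _ := by ring

/-- Local flow of a `C²` vector field `F` together with its derivative in the initial condition,
which solves the variational equation. -/
theorem exists_flow_hasFDerivAt [CompleteSpace V] {F : V → V} {z₀ : V}
    (hF : ContDiffAt ℝ 2 F z₀) {W : Set V} (hW : W ∈ 𝓝 z₀) :
    ∃ r > 0, ∃ ε > 0, ∃ Z : V → ℝ → V, ∃ Y : V → ℝ → V →L[ℝ] V, ∀ z ∈ Metric.ball z₀ r,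
      Z z 0 = z ∧ Y z 0 = ContinuousLinearMap.id ℝ V ∧ ∀ t ∈ Ico (0 : ℝ) ε,
        Z z t ∈ W ∧ HasDerivAt (Z z) (F (Z z t)) t ∧
        HasDerivAt (Y z) ((fderiv ℝ F (Z z t)).comp (Y z t)) t ∧
        HasFDerivAt (fun z' => Z z' t) (Y z t) z := by
  -- The equation and its linearization are solved as a single system started at (z, id), so the
  -- flow and its candidate derivative share their domain.
  obtain ⟨ε, hε, a, r, L, K, hr, hPL⟩ := IsPicardLindelof.of_contDiffAt_one
    (contDiffAt_variationalField (A := ContinuousLinearMap.id ℝ V) hF)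
  obtain ⟨α, hα, L', hL'⟩ :=
    (hPL 0).exists_forall_mem_closedBall_eq_hasDerivWithinAt_lipschitzOnWith
  simp only [zero_sub, zero_add] at hα hL'
  obtain ⟨K₁, s₁, hs₁, hK₁⟩ := (hF.fderiv_right (m := 1) (by norm_num)).exists_lipschitzOnWith
  have hdiff : ∀ᶠ z in 𝓝 z₀, DifferentiableAt ℝ F z :=
    ((hF.of_le (m := 1) (by norm_num)).eventually (by simp)).mono
      fun z hz => hz.differentiableAt (by norm_num)
  have hbd : ∀ᶠ z in 𝓝 z₀, ‖fderiv ℝ F z‖ < ‖fderiv ℝ F z₀‖ + 1 :=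
    (hF.fderiv_right (m := 1) (by norm_num)).continuousAt.norm.eventually_lt
      continuousAt_const (by linarith)
  obtain ⟨ρ, hρ, hρW⟩ := Metric.eventually_nhds_iff_ball.1
    (hdiff.and (hbd.and (Filter.Eventually.and hs₁ hW)))
  have hcont : ContinuousOn (Function.uncurry α)
      (Metric.closedBall (z₀, ContinuousLinearMap.id ℝ V) r ×ˢ Icc (-ε) ε) :=
    continuousOn_prod_of_continuousOn_lipschitzOnWith _ L'
      (fun x hx => HasDerivWithinAt.continuousOn (hα x hx).2) hL'
  have hcont0 : ContinuousAt (Function.uncurry α) ((z₀, ContinuousLinearMap.id ℝ V), 0) :=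
    hcont.continuousAt (prod_mem_nhds (Metric.closedBall_mem_nhds _ (by exact_mod_cast hr))
      (Icc_mem_nhds (by linarith) hε))
  have hmem : ∀ᶠ w in 𝓝 ((z₀, ContinuousLinearMap.id ℝ V), (0 : ℝ)),
      (Function.uncurry α w).1 ∈ Metric.ball z₀ ρ := by
    refine (continuousAt_fst.comp hcont0).eventually_mem ?_
    have : α (z₀, ContinuousLinearMap.id ℝ V) 0 = (z₀, ContinuousLinearMap.id ℝ V) :=
      (hα _ (Metric.mem_closedBall_self r.2)).1
    simpa [this] using Metric.ball_mem_nhds z₀ hρ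
  obtain ⟨δ, hδ, hδρ⟩ := Metric.eventually_nhds_iff_ball.1 hmem
  let Z : V → ℝ → V := fun z t => (α (z, ContinuousLinearMap.id ℝ V) t).1
  let Y : V → ℝ → V →L[ℝ] V := fun z t => (α (z, ContinuousLinearMap.id ℝ V) t).2
  have hball : ∀ z ∈ Metric.ball z₀ (min δ r), (z, ContinuousLinearMap.id ℝ V) ∈
      Metric.closedBall (z₀, ContinuousLinearMap.id ℝ V) (r : ℝ) := by
    intro z hz
    simp only [Metric.mem_ball, lt_min_iff] at hz
    simp [Prod.dist_eq, hz.2.le]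
  have hZY : ∀ z ∈ Metric.ball z₀ (min δ r), ∀ t ∈ Ico (0 : ℝ) (min δ ε),
      Z z t ∈ Metric.ball z₀ ρ ∧ HasDerivAt (Z z) (F (Z z t)) t ∧
        HasDerivAt (Y z) ((fderiv ℝ F (Z z t)).comp (Y z t)) t := by
    intro z hz t ht
    have h1 := (hα _ (hball z hz)).2 t ⟨by linarith [ht.1], (ht.2.trans_le (min_le_right _ _)).le⟩
    have h2 := h1.hasDerivAt (Icc_mem_nhds (by linarith [ht.1])
      (ht.2.trans_le (min_le_right _ _)))
    refine ⟨?_, h2.fst, h2.snd⟩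
    refine hδρ ((z, ContinuousLinearMap.id ℝ V), t) ?_
    simp only [Metric.mem_ball, lt_min_iff] at hz
    have := ht.2.trans_le (min_le_left _ _)
    simp [Prod.dist_eq, hz.1, abs_of_nonneg ht.1, this]
  refine ⟨min δ r, lt_min hδ (by exact_mod_cast hr), min δ ε, lt_min hδ hε, Z, Y, fun z hz => ?_⟩
  have hz0 := (hα _ (hball z hz)).1
  refine ⟨congrArg Prod.fst hz0, congrArg Prod.snd hz0, fun t ht => ?_⟩
  obtain ⟨h1, h2, h3⟩ := hZY z hz t ht
  refine ⟨(hρW _ h1).2.2.2, h2, h3, ?_⟩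
  set K₂ : ℝ := ‖fderiv ℝ F z₀‖ + 1 with hK₂
  have hK₂pos : 0 < K₂ := by positivity
  -- The defect of linearization solves w' = DF(Z)w + remainder with w(0) = 0. The remainder is
  -- quadratic in z' - z because DF and the flow are Lipschitz, so Grönwall's inequality makes w
  -- quadratic in z' - z.
  have hest : ∀ z' ∈ Metric.ball z₀ (min δ r), ‖Z z' t - Z z t - Y z t (z' - z)‖ ≤
      (K₁ * L' ^ 2 / K₂ * (Real.exp (K₂ * t) - 1)) * ‖z' - z‖ ^ 2 := by
    intro z' hz'
    have hw : ∀ s ∈ Ico (0 : ℝ) (min δ ε),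
        HasDerivAt (fun s => Z z' s - Z z s - Y z s (z' - z))
        (F (Z z' s) - F (Z z s) - (fderiv ℝ F (Z z s)) (Y z s (z' - z))) s := by
      intro s hs
      have := (hZY z hz s hs).2.2.clm_apply (hasDerivAt_const s (z' - z))
      simp only [map_zero, add_zero, ContinuousLinearMap.comp_apply] at this
      exact ((hZY z' hz' s hs).2.1.sub (hZY z hz s hs).2.1).sub this
    have hsub : ∀ s ∈ Icc 0 t, s ∈ Ico (0 : ℝ) (min δ ε) := fun s hs => ⟨hs.1, hs.2.trans_lt ht.2⟩
    have hz0' := (hα _ (hball z' hz')).1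
    have := norm_le_gronwallBound_of_norm_deriv_right_le (δ := 0) (K := K₂)
      (ε := K₁ * L' ^ 2 * ‖z' - z‖ ^ 2) (a := 0) (b := t)
      (fun s hs => (hw s (hsub s hs)).continuousAt.continuousWithinAt)
      (fun s hs => (hw s (hsub s (Ico_subset_Icc_self hs))).hasDerivWithinAt)
      (by simp [Z, Y, hz0, hz0'])
      (fun s hs => by
        have hs' := hsub s (Ico_subset_Icc_self hs)
        have ha := (hZY z hz s hs').1
        have hb := (hZY z' hz' s hs').1
        have e1 := norm_sub_sub_fderiv_le (fun z hz => (hρW z hz).1)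
          (hK₁.mono fun z hz => (hρW z hz).2.2.1) ha hb
        have e2 : ‖Z z' s - Z z s‖ ≤ L' * ‖z' - z‖ := by
          have := (hL' s ⟨by linarith [hs.1], (hs'.2.trans_le (min_le_right _ _)).le⟩).dist_le_mul
            _ (hball z' hz') _ (hball z hz)
          rw [← dist_eq_norm, ← dist_eq_norm]
          calc dist (Z z' s) (Z z s) ≤ dist (α (z', _) s) (α (z, _) s) := by
                rw [Prod.dist_eq (x := α _ _)]; exact le_max_left _ _
            _ ≤ _ := this
            _ = _ := by simp [Prod.dist_eq]
        have e3 : F (Z z' s) - F (Z z s) - (fderiv ℝ F (Z z s)) (Y z s (z' - z)) =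
            (fderiv ℝ F (Z z s)) (Z z' s - Z z s - Y z s (z' - z)) +
            (F (Z z' s) - F (Z z s) - fderiv ℝ F (Z z s) (Z z' s - Z z s)) := by
          simp only [map_sub]; abel
        rw [e3]
        refine (norm_add_le _ _).trans (add_le_add ?_ (e1.trans ?_))
        · exact (ContinuousLinearMap.le_opNorm _ _).trans (by gcongr; exact (hρW _ ha).2.1.le)
        · calc (K₁ : ℝ) * ‖Z z' s - Z z s‖ ^ 2 ≤ K₁ * (L' * ‖z' - z‖) ^ 2 := by gcongr
            _ = _ := by ring)
      t ⟨ht.1, le_rfl⟩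
    rw [gronwallBound_of_K_ne_0 hK₂pos.ne'] at this
    simp only [sub_zero, zero_mul, zero_add] at this
    exact this.trans_eq (by ring)
  rw [hasFDerivAt_iff_isLittleO]
  have hO : (fun z' => Z z' t - Z z t - Y z t (z' - z)) =O[𝓝 z] fun z' => ‖z' - z‖ ^ 2 := by
    refine Asymptotics.IsBigO.of_bound (K₁ * L' ^ 2 / K₂ * (Real.exp (K₂ * t) - 1)) ?_
    filter_upwards [Metric.isOpen_ball.mem_nhds hz] with z' hz'
    simpa using hest z' hz'
  refine hO.trans_isLittleO ?_
  have := (Asymptotics.isLittleO_norm_pow_id (E' := V) (n := 2) (by norm_num)).comp_tendsto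
    (k := fun z' : V => z' - z) (l' := 𝓝 z) (by
      have : ContinuousAt (fun z' : V => z' - z) z := by fun_prop
      simpa [ContinuousAt] using this)
  exact this

end Flow

/-! ### Jacobi fields over short times -/

section Jacobi

variable {E : Type*} [NormedAddCommGroup E] [NormedSpace ℝ E]

/-- Cauchy-Schwarz for the semidefinite form η(Pζ), tested on a functional ζ of norm at most one
that norms Pη. -/
theorem norm_sq_apply_le_of_symm_nonneg {P : (E →L[ℝ] ℝ) →L[ℝ] E} {K : ℝ}
    (hsymm : ∀ η ζ : E →L[ℝ] ℝ, η (P ζ) = ζ (P η)) (hpos : ∀ η : E →L[ℝ] ℝ, 0 ≤ η (P η))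
    (hK : ‖P‖ ≤ K) (η : E →L[ℝ] ℝ) : ‖P η‖ ^ 2 ≤ K * η (P η) := by
  obtain ⟨ζ, hζ1, hζ⟩ := exists_dual_vector'' ℝ (P η)
  have hcs := LinearMap.BilinForm.apply_mul_apply_le_of_forall_zero_le
    (LinearMap.mk₂ ℝ (fun a b : E →L[ℝ] ℝ => a (P b)) (by simp) (by simp) (by simp) (by simp))
    hpos ζ η
  simp only [LinearMap.mk₂_apply] at hcs
  rw [hsymm η ζ, hζ] at hcs
  have h1 : ζ (P ζ) ≤ K := by
    calc ζ (P ζ) ≤ ‖ζ (P ζ)‖ := le_abs_self _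
      _ ≤ ‖ζ‖ * (‖P‖ * ‖ζ‖) := (ζ.le_opNorm _).trans (by gcongr; exact P.le_opNorm _)
      _ ≤ 1 * (‖P‖ * 1) := by gcongr
      _ ≤ K := by simpa using hK
  calc ‖P η‖ ^ 2 ≤ ζ (P ζ) * η (P η) := by simpa [sq] using hcs
    _ ≤ K * η (P η) := mul_le_mul_of_nonneg_right h1 (hpos η)

/-- For short times, a Jacobi field of a linear Hamiltonian system whose Hamiltonian is
nonnegative in the momenta and whose position component vanishes at both ends has vanishing
position component. -/
theorem jacobi_fst_eq_zero {x : ℝ → E} {ξ : ℝ → E →L[ℝ] ℝ} {P : ℝ → (E →L[ℝ] ℝ) →L[ℝ] E}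
    {A : ℝ → E →L[ℝ] E} {C : ℝ → E →L[ℝ] E →L[ℝ] ℝ} {K t : ℝ} (hK : 0 ≤ K) (ht : 0 < t)
    (htK : t * (1 + K) ^ 2 < 2)
    (hsymm : ∀ s ∈ Icc 0 t, ∀ η ζ : E →L[ℝ] ℝ, η (P s ζ) = ζ (P s η))
    (hpos : ∀ s ∈ Icc 0 t, ∀ η : E →L[ℝ] ℝ, 0 ≤ η (P s η))
    (hP : ∀ s ∈ Icc 0 t, ‖P s‖ ≤ K) (hA : ∀ s ∈ Icc 0 t, ‖A s‖ ≤ K)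
    (hC : ∀ s ∈ Icc 0 t, ‖C s‖ ≤ K)
    (hx : ∀ s ∈ Icc 0 t, HasDerivAt x (A s (x s) + P s (ξ s)) s)
    (hξ : ∀ s ∈ Icc 0 t, HasDerivAt ξ (C s (x s) - (ξ s).comp (A s)) s)
    (h0 : x 0 = 0) (h1 : x t = 0) : ∀ s ∈ Icc 0 t, x s = 0 := by
  have hxc : ContinuousOn x (Icc 0 t) := fun s hs => (hx s hs).continuousAt.continuousWithinAt
  obtain ⟨m, hm, hmax⟩ := isCompact_Icc.exists_isMaxOn ⟨0, left_mem_Icc.2 ht.le⟩ hxc.norm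
  set M := ‖x m‖ with hM
  have hle : ∀ s ∈ Icc 0 t, ‖x s‖ ≤ M := fun s hs => hmax hs
  rcases (norm_nonneg (x m)).eq_or_lt with h | hMpos
  · intro s hs
    exact norm_le_zero_iff.1 ((hle s hs).trans h.symm.le)
  exfalso
  rw [← hM] at hMpos
  -- A majorant of ‖x‖. The term ‖Pξ‖ is bounded by M/2 + ‖Pξ‖²/(2M), hence by M/2 + K/(2M) ξ(Pξ),
  -- and ξ(Pξ) = (ξ(x))' - C(x, x) ≤ (ξ(x))' + KM². The contributions of A to (ξ(x))' cancel.
  let g : ℝ → ℝ := fun s => (M / 2 + K * M) * s + K / (2 * M) * (ξ s (x s) + K * M ^ 2 * s)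
  let g' : ℝ → ℝ := fun s => (M / 2 + K * M) +
    K / (2 * M) * (ξ s (P s (ξ s)) + C s (x s) (x s) + K * M ^ 2)
  have hg : ∀ s ∈ Icc 0 t, HasDerivAt g (g' s) s := by
    intro s hs
    have hc := (hξ s hs).clm_apply (hx s hs)
    have hc2 := ((hasDerivAt_id s).const_mul (M / 2 + K * M)).add
      ((hc.add ((hasDerivAt_id s).const_mul (K * M ^ 2))).const_mul (K / (2 * M)))
    refine HasDerivAt.congr_deriv (f := g) hc2 ?_
    rw [show (C s (x s) - (ξ s).comp (A s)) (x s) = C s (x s) (x s) - ξ s (A s (x s)) from rfl,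
      map_add]
    simp only [g']
    ring
  have hCx : ∀ s ∈ Icc 0 t, 0 ≤ C s (x s) (x s) + K * M ^ 2 := by
    intro s hs
    have h2 : |C s (x s) (x s)| ≤ K * M ^ 2 := by
      calc |C s (x s) (x s)| ≤ ‖C s‖ * ‖x s‖ * ‖x s‖ := (C s).le_opNorm₂ _ _
        _ ≤ K * M * M := by gcongr <;> first | exact hC s hs | exact hle s hs
        _ = K * M ^ 2 := by ring
    linarith [neg_abs_le (C s (x s) (x s))]
  have hPξ : ∀ s ∈ Icc 0 t, ‖P s (ξ s)‖ ≤ M / 2 + K / (2 * M) * ξ s (P s (ξ s)) := by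
    intro s hs
    have h2 := norm_sq_apply_le_of_symm_nonneg (hsymm s hs) (hpos s hs) (hP s hs) (ξ s)
    have h3 : 2 * M * ‖P s (ξ s)‖ ≤ M ^ 2 + K * ξ s (P s (ξ s)) := by
      nlinarith [sq_nonneg (M - ‖P s (ξ s)‖)]
    have h4 : M / 2 + K / (2 * M) * ξ s (P s (ξ s)) =
        (M ^ 2 + K * ξ s (P s (ξ s))) / (2 * M) := by field_simp
    rw [h4, le_div_iff₀ (by positivity)]
    linarith
  have hbound : ∀ s ∈ Icc 0 t, ‖A s (x s) + P s (ξ s)‖ ≤ g' s := by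
    intro s hs
    have h2 : ‖A s (x s)‖ ≤ K * M := (A s).le_of_opNorm_le_of_le (hA s hs) (hle s hs)
    have h3 := mul_nonneg (by positivity : 0 ≤ K / (2 * M)) (hCx s hs)
    have h4 := norm_add_le (A s (x s)) (P s (ξ s))
    have h5 := hPξ s hs
    simp only [g']
    linarith
  have hgc : ContinuousOn g (Icc 0 t) := fun s hs => (hg s hs).continuousAt.continuousWithinAt
  have hxg := image_norm_le_of_norm_deriv_right_le_deriv_boundary' hxc
    (fun s hs => (hx s (Ico_subset_Icc_self hs)).hasDerivWithinAt) (B := g) (B' := g')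
    (by simp [g, h0]) hgc (fun s hs => (hg s (Ico_subset_Icc_self hs)).hasDerivWithinAt)
    (fun s hs => hbound s (Ico_subset_Icc_self hs)) hm
  have hmono : MonotoneOn g (Icc 0 t) := monotoneOn_of_hasDerivWithinAt_nonneg (convex_Icc 0 t) hgc
    (fun s hs => (hg s (interior_subset hs)).hasDerivWithinAt)
    (fun s hs => (norm_nonneg _).trans (hbound s (interior_subset hs)))
  have hgt := hmono hm (right_mem_Icc.2 ht.le) hm.2
  -- Since x vanishes at t, the boundary term ξ(x) disappears and g(t) = M t(1 + K)²/2, which is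
  -- less than M. This contradicts M = ‖x(m)‖ ≤ g(m) ≤ g(t).
  have hgt' : g t = M * (t * (1 + K) ^ 2 / 2) := by
    simp only [g, h1, map_zero]
    field_simp
    ring
  nlinarith

end Jacobi

/-! ### Hamilton's equations of a contact cometric -/

section Cometric

variable {E : Type*} [NormedAddCommGroup E] [NormedSpace ℝ E]

/-- The Hamiltonian vector field of `(x, ξ) ↦ 1/2 * ξ (B x ξ)`. -/
noncomputable def cometricField (B : E → (E →L[ℝ] ℝ) →L[ℝ] E) (z : E × (E →L[ℝ] ℝ)) :
    E × (E →L[ℝ] ℝ) :=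
  (B z.1 z.2, -(1 / 2 : ℝ) • z.2.comp ((fderiv ℝ B z.1).flip z.2))

/-- `B` is a smooth symmetric nonnegative cometric on the open set `Ω` whose kernel is spanned by
the 1-form `θ`, and `dθ` is nondegenerate on the kernel of `θ` at `x₀`. -/
structure IsContactCometric (B : E → (E →L[ℝ] ℝ) →L[ℝ] E) (θ : E → E →L[ℝ] ℝ) (Ω : Set E)
    (x₀ : E) : Prop where
  isOpen : IsOpen Ω
  mem : x₀ ∈ Ω
  contDiffOn : ContDiffOn ℝ ∞ B Ω
  symm : ∀ x ∈ Ω, ∀ η ζ : E →L[ℝ] ℝ, η (B x ζ) = ζ (B x η)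
  nonneg : ∀ x ∈ Ω, ∀ η : E →L[ℝ] ℝ, 0 ≤ η (B x η)
  apply_form : ∀ x ∈ Ω, B x (θ x) = 0
  eq_smul : ∀ x ∈ Ω, ∀ η : E →L[ℝ] ℝ, B x η = 0 → ∃ f : ℝ, η = f • θ x
  form_ne : θ x₀ ≠ 0
  differentiableAt : DifferentiableAt ℝ θ x₀
  nondegenerate : ∀ v, v ≠ 0 → θ x₀ v = 0 → ∃ u, θ x₀ u = 0 ∧ dOneForm θ x₀ v u ≠ 0

theorem ContDiffAt.cometricField {B : E → (E →L[ℝ] ℝ) →L[ℝ] E} {z : E × (E →L[ℝ] ℝ)}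
    (hB : ContDiffAt ℝ ∞ B z.1) : ContDiffAt ℝ ∞ (cometricField B) z := by
  have hB' : ContDiffAt ℝ ∞ (fderiv ℝ B) z.1 := hB.fderiv_right (m := ∞) (by simp)
  have h1 : ContDiffAt ℝ ∞ (fun z : E × (E →L[ℝ] ℝ) => (fderiv ℝ B z.1).flip) z :=
    (ContinuousLinearMap.flipₗᵢ ℝ E (E →L[ℝ] ℝ) E).contDiff.contDiffAt.comp z
      (hB'.comp z contDiffAt_fst)
  exact ((hB.comp z contDiffAt_fst).clm_apply contDiffAt_snd).prodMk
    ((contDiffAt_snd.clm_comp (h1.clm_apply contDiffAt_snd)).const_smul (-(1 / 2 : ℝ)))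

namespace IsContactCometric

variable {B : E → (E →L[ℝ] ℝ) →L[ℝ] E} {θ : E → E →L[ℝ] ℝ} {Ω : Set E} {x₀ : E}

theorem contDiffAt (h : IsContactCometric B θ Ω x₀) {x : E} (hx : x ∈ Ω) : ContDiffAt ℝ ∞ B x :=
  h.contDiffOn.contDiffAt (h.isOpen.mem_nhds hx)

theorem hasFDerivAt (h : IsContactCometric B θ Ω x₀) {x : E} (hx : x ∈ Ω) :
    HasFDerivAt B (fderiv ℝ B x) x :=
  ((h.contDiffAt hx).differentiableAt (by simp)).hasFDerivAt

theorem fderiv_symm (h : IsContactCometric B θ Ω x₀) {x : E} (hx : x ∈ Ω) (u : E)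
    (η ζ : E →L[ℝ] ℝ) : η (fderiv ℝ B x u ζ) = ζ (fderiv ℝ B x u η) := by
  have h1 : ∀ η ζ : E →L[ℝ] ℝ, HasFDerivAt (fun y => η (B y ζ))
      (η.comp ((fderiv ℝ B x).flip ζ)) x := fun η ζ =>
    η.hasFDerivAt.comp x (((h.hasFDerivAt hx).clm_apply (hasFDerivAt_const ζ x)).congr_fderiv
      (by ext; simp))
  have h2 := (h1 ζ η).congr_of_eventuallyEq (f₁ := fun y => η (B y ζ)) (by
    filter_upwards [h.isOpen.mem_nhds hx] with y hy using h.symm y hy η ζ)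
  simpa using congrArg (fun L : E →L[ℝ] ℝ => L u) ((h1 η ζ).unique h2)

/-- The momentum equation is quadratic in ξ; by symmetry of the derivative of B the two halves of
its polarization agree, which removes the factor 1/2. The lower right block is therefore minus the
adjoint of the upper left one, the form required of a Jacobi equation. -/
theorem fderiv_cometricField_inr (h : IsContactCometric B θ Ω x₀) {z : E × (E →L[ℝ] ℝ)}
    (hz : z.1 ∈ Ω) (η : E →L[ℝ] ℝ) : fderiv ℝ (cometricField B) z (0, η) =
      (B z.1 η, -η.comp ((fderiv ℝ B z.1).flip z.2)) := by
  have hF : DifferentiableAt ℝ (cometricField B) z :=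
    (ContDiffAt.cometricField (h.contDiffAt hz)).differentiableAt (by simp)
  have h1 : HasFDerivAt (fun ζ => cometricField B (z.1, ζ))
      ((fderiv ℝ (cometricField B) z).comp (ContinuousLinearMap.inr ℝ E (E →L[ℝ] ℝ))) z.2 :=
    HasFDerivAt.comp (g := cometricField B) z.2 hF.hasFDerivAt (hasFDerivAt_prodMk_right z.1 z.2)
  have h2 := (B z.1).hasFDerivAt (x := z.2)
  have h3 := ((hasFDerivAt_id (𝕜 := ℝ) z.2).clm_comp
    ((fderiv ℝ B z.1).flip.hasFDerivAt (x := z.2))).const_smul (-(1 / 2 : ℝ))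
  have h4 := congrArg (fun L => L η) (h1.unique (h2.prodMk h3))
  simp only [ContinuousLinearMap.comp_apply, ContinuousLinearMap.inr_apply] at h4
  rw [h4]
  refine Prod.ext rfl ?_
  ext u
  have := h.fderiv_symm hz u z.2 η
  simp [this]
  ring

theorem fderiv_cometricField_inl_fst (h : IsContactCometric B θ Ω x₀) {z : E × (E →L[ℝ] ℝ)}
    (hz : z.1 ∈ Ω) (w : E) : (fderiv ℝ (cometricField B) z (w, 0)).1 =
      (fderiv ℝ B z.1).flip z.2 w := by
  have hF : DifferentiableAt ℝ (cometricField B) z :=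
    (ContDiffAt.cometricField (h.contDiffAt hz)).differentiableAt (by simp)
  have h1 := hF.hasFDerivAt.fst
  have h2 : HasFDerivAt (fun y : E × (E →L[ℝ] ℝ) => B y.1 y.2) _ z :=
    ((h.hasFDerivAt hz).comp z hasFDerivAt_fst).clm_apply hasFDerivAt_snd
  simpa using congrArg (fun L => L (w, 0)) (h1.unique h2)

/-- A Jacobi field along an extremal with nonzero velocity whose position component vanishes on a
time interval is zero. -/
theorem jacobi_snd_eq_zero (h : IsContactCometric B θ Ω x₀) {x : ℝ → E} {η : ℝ → E →L[ℝ] ℝ}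
    {ξ₀ : E →L[ℝ] ℝ} {t : ℝ} (ht : 0 < t) (hξ₀ : B x₀ ξ₀ ≠ 0) (hx0 : x 0 = x₀)
    (hxΩ : ∀ s ∈ Icc 0 t, x s ∈ Ω) (hx : HasDerivAt x (B x₀ ξ₀) 0)
    (hη : HasDerivAt η (-(η 0).comp ((fderiv ℝ B x₀).flip ξ₀)) 0)
    (hker : ∀ s ∈ Icc 0 t, B (x s) (η s) = 0) : η 0 = 0 := by
  obtain ⟨f, hf⟩ := h.eq_smul x₀ h.mem (η 0) (by simpa [hx0] using hker 0 (left_mem_Icc.2 ht.le))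
  -- Differentiation of B(x)θ(x) = 0, paired with ξ₀.
  have hDB : ∀ u, ξ₀ (fderiv ℝ B x₀ u (θ x₀)) = -(fderiv ℝ θ x₀ u (B x₀ ξ₀)) := by
    intro u
    have h1 := ((h.hasFDerivAt h.mem).clm_apply h.differentiableAt.hasFDerivAt)
    have h2 := h1.unique ((hasFDerivAt_const (0 : E) x₀).congr_of_eventuallyEq (by
      filter_upwards [h.isOpen.mem_nhds h.mem] with y hy using h.apply_form y hy))
    have h3 : fderiv ℝ B x₀ u (θ x₀) = -B x₀ (fderiv ℝ θ x₀ u) := by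
      have := congrArg (fun L : E →L[ℝ] E => L u) h2
      simp at this
      exact eq_neg_of_add_eq_zero_right this
    rw [h3, map_neg, h.symm x₀ h.mem]
  obtain ⟨r, hr⟩ : ∃ r, θ x₀ r ≠ 0 := by
    by_contra! hc
    exact h.form_ne (ContinuousLinearMap.ext hc)
  have hv : θ x₀ (B x₀ ξ₀) = 0 := by rw [h.symm x₀ h.mem, h.apply_form x₀ h.mem, map_zero]
  obtain ⟨u, hu, hdu⟩ := h.nondegenerate _ hξ₀ hv
  have hθx : HasDerivAt (fun s => θ (x s)) (fderiv ℝ θ x₀ (B x₀ ξ₀)) 0 := by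
    have h1 : HasFDerivAt θ (fderiv ℝ θ x₀) (x 0) := by
      rw [hx0]; exact h.differentiableAt.hasFDerivAt
    exact h1.comp_hasDerivAt 0 hx
  have happ : ∀ {α : ℝ → E →L[ℝ] ℝ} {α' : E →L[ℝ] ℝ} (w : E), HasDerivAt α α' 0 →
      HasDerivAt (fun s => α s w) (α' w) 0 := fun w hα => by
    simpa using hα.clm_apply (hasDerivAt_const 0 w)
  have hd1 := (happ r hθx).mul (happ u hη)
  have hd2 := (happ r hη).mul (happ u hθx)
  -- The factor c in η = cθ is not known to be differentiable. Proportionality is therefore written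
  -- as a vanishing 2×2 minor on the vectors r and u, whose derivative at 0 within [0, t] makes
  -- sense.
  have heq : ∀ s ∈ Icc 0 t, θ (x s) r * η s u = η s r * θ (x s) u := by
    intro s hs
    obtain ⟨c, hc⟩ := h.eq_smul _ (hxΩ s hs) _ (hker s hs)
    simp [hc]
    ring
  have h5 := UniqueDiffWithinAt.eq_deriv _ (uniqueDiffOn_Icc ht 0 (left_mem_Icc.2 ht.le)) hd1.hasDerivWithinAt
    (hd2.hasDerivWithinAt.congr (fun s hs => heq s hs) (heq 0 (left_mem_Icc.2 ht.le)))
  simp only [hx0, hf, hu] at h5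
  simp [hu] at h5
  have h6 := h.fderiv_symm h.mem u (θ x₀) ξ₀
  rw [h6, hDB] at h5
  -- With v = B x₀ ξ₀ and θ(u) = 0, the differentiated minor reads θ(r) η'(u) = f θ(r) (D_vθ)(u),
  -- while η'(u) = f (D_uθ)(v).
  have h7 : θ x₀ r * f * dOneForm θ x₀ (B x₀ ξ₀) u = 0 := by
    unfold dOneForm
    linear_combination -h5
  have hf0 : f = 0 := by
    rcases mul_eq_zero.1 h7 with h8 | h8
    · exact (mul_eq_zero.1 h8).resolve_left hr
    · exact absurd h8 hdu
  rw [hf, hf0, zero_smul]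

end IsContactCometric

end Cometric

/-! ### The exponential in a chart is a submersion for short times -/

section LocalExponential

variable {E : Type*} [NormedAddCommGroup E] [NormedSpace ℝ E]

theorem norm_fst_apply_inr_le {F G : Type*} [NormedAddCommGroup F] [NormedSpace ℝ F]
    [NormedAddCommGroup G] [NormedSpace ℝ G] (L : F × G →L[ℝ] F × G) (η : G) :
    ‖(L (0, η)).1‖ ≤ ‖L‖ * ‖η‖ := by
  calc ‖(L (0, η)).1‖ ≤ ‖L (0, η)‖ := norm_fst_le _
    _ ≤ ‖L‖ * ‖((0 : F), η)‖ := L.le_opNorm _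
    _ = _ := by simp [Prod.norm_def]

theorem finrank_continuousDual [FiniteDimensional ℝ E] :
    Module.finrank ℝ (E →L[ℝ] ℝ) = Module.finrank ℝ E :=
  (LinearMap.toContinuousLinearMap (𝕜 := ℝ) (E := E) (F' := ℝ)).symm.finrank_eq.trans
    Subspace.dual_finrank_eq

/-- The derivative in ξ of the position at time t sends η to the position part of the Jacobi field
started at (0, η). Such a field with vanishing final position is zero by the two Jacobi lemmas. The
radius and the time are uniform near ξ₀, as needed for the compactness argument. -/
theorem IsContactCometric.exists_flow [FiniteDimensional ℝ E]
    {B : E → (E →L[ℝ] ℝ) →L[ℝ] E} {θ : E → E →L[ℝ] ℝ} {Ω : Set E} {x₀ : E}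
    (h : IsContactCometric B θ Ω x₀) {ξ₀ : E →L[ℝ] ℝ} (hξ₀ : B x₀ ξ₀ ≠ 0) :
    ∃ r > 0, ∃ ε > 0, ∃ Z : (E →L[ℝ] ℝ) → ℝ → E × (E →L[ℝ] ℝ), ∀ ξ ∈ Metric.ball ξ₀ r,
      Z ξ 0 = (x₀, ξ) ∧ ∀ t ∈ Ico (0 : ℝ) ε, (Z ξ t).1 ∈ Ω ∧
        HasDerivAt (Z ξ) (cometricField B (Z ξ t)) t ∧
        ∃ D : (E →L[ℝ] ℝ) →L[ℝ] E, HasFDerivAt (fun ξ' => (Z ξ' t).1) D ξ ∧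
          (0 < t → Function.Surjective D) := by
  have hF : ContDiffAt ℝ ∞ (cometricField B) (x₀, ξ₀) :=
    ContDiffAt.cometricField (h.contDiffAt h.mem)
  set K : ℝ := ‖fderiv ℝ (cometricField B) (x₀, ξ₀)‖ + 1 with hK
  have hK0 : 0 < K := by positivity
  have hW : {z : E × (E →L[ℝ] ℝ) | z.1 ∈ Ω ∧ ‖fderiv ℝ (cometricField B) z‖ < K} ∈
      𝓝 (x₀, ξ₀) := by
    refine Filter.inter_mem (continuousAt_fst.preimage_mem_nhds (h.isOpen.mem_nhds h.mem)) ?_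
    exact (hF.fderiv_right (m := ∞) (by simp)).continuousAt.norm.eventually_lt
      continuousAt_const (by linarith)
  obtain ⟨r, hr, ε, hε, Z, Y, hZ⟩ := exists_flow_hasFDerivAt (hF.of_le (by norm_cast)) hW
  obtain ⟨r', hr', hr''⟩ := Metric.eventually_nhds_iff_ball.1
    ((B x₀).continuous.continuousAt.eventually_ne hξ₀)
  -- The time bound gives t(1 + K)² < 1, within the range allowed by `jacobi_fst_eq_zero`; r' keeps
  -- the initial velocity B x₀ ξ nonzero.
  refine ⟨min r r', lt_min hr hr', min ε (1 / (1 + K) ^ 2), lt_min hε (by positivity),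
    fun ξ => Z (x₀, ξ), fun ξ hξ => ?_⟩
  have hzr : (x₀, ξ) ∈ Metric.ball (x₀, ξ₀) r := by
    rw [Metric.mem_ball, lt_min_iff] at hξ
    simp [Prod.dist_eq, hξ.1]
  have hBξ : B x₀ ξ ≠ 0 := hr'' ξ (Metric.ball_subset_ball (min_le_right _ _) hξ)
  obtain ⟨hZ0, hY0, hZt⟩ := hZ _ hzr
  refine ⟨hZ0, fun t ht => ?_⟩
  have ht' : t ∈ Ico 0 ε := ⟨ht.1, ht.2.trans_le (min_le_left _ _)⟩
  obtain ⟨h1, h2, -, h4⟩ := hZt t ht'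
  let D : (E →L[ℝ] ℝ) →L[ℝ] E := (ContinuousLinearMap.fst ℝ E (E →L[ℝ] ℝ)).comp
    ((Y (x₀, ξ) t).comp (ContinuousLinearMap.inr ℝ E (E →L[ℝ] ℝ)))
  refine ⟨h1.1, h2, D, ?_, fun htpos => ?_⟩
  · have := h4.comp ξ (hasFDerivAt_prodMk_right x₀ ξ)
    exact this.fst
  -- Covectors and positions have the same dimension, so injectivity suffices.
  refine (LinearMap.injective_iff_surjective_of_finrank_eq_finrank (f := (D : _ →ₗ[ℝ] E))
    finrank_continuousDual).1 ?_
  rw [injective_iff_map_eq_zero]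
  intro η hη
  have hη' : (Y (x₀, ξ) t (0, η)).1 = 0 := hη
  have hsub : ∀ s ∈ Icc 0 t, s ∈ Ico 0 ε := fun s hs => ⟨hs.1, hs.2.trans_lt ht'.2⟩
  let z : ℝ → E × (E →L[ℝ] ℝ) := Z (x₀, ξ)
  let y : ℝ → E × (E →L[ℝ] ℝ) := fun s => Y (x₀, ξ) s (0, η)
  -- The blocks of the linearized Hamiltonian field along the extremal; all are bounded by the norm
  -- of the full derivative, hence by K.
  let P : ℝ → (E →L[ℝ] ℝ) →L[ℝ] E := fun s => B (z s).1
  let A : ℝ → E →L[ℝ] E := fun s => (fderiv ℝ B (z s).1).flip (z s).2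
  let C : ℝ → E →L[ℝ] E →L[ℝ] ℝ := fun s => (ContinuousLinearMap.snd ℝ E (E →L[ℝ] ℝ)).comp
    ((fderiv ℝ (cometricField B) (z s)).comp (ContinuousLinearMap.inl ℝ E (E →L[ℝ] ℝ)))
  have hzΩ : ∀ s ∈ Icc 0 t, (z s).1 ∈ Ω := fun s hs => (hZt s (hsub s hs)).1.1
  have hDK : ∀ s ∈ Icc 0 t, ‖fderiv ℝ (cometricField B) (z s)‖ ≤ K :=
    fun s hs => (hZt s (hsub s hs)).1.2.le
  have hy : ∀ s ∈ Icc 0 t, HasDerivAt y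
      (A s (y s).1 + P s (y s).2, C s (y s).1 - (y s).2.comp (A s)) s := by
    intro s hs
    have hd := (hZt s (hsub s hs)).2.2.1.clm_apply (hasDerivAt_const s ((0 : E), η))
    refine hd.congr_deriv ?_
    have e1 : y s = ((y s).1, 0) + (0, (y s).2) := by simp
    have e2 : fderiv ℝ (cometricField B) (z s) (y s) =
        fderiv ℝ (cometricField B) (z s) ((y s).1, 0) +
          (B (z s).1 (y s).2, -(y s).2.comp ((fderiv ℝ B (z s).1).flip (z s).2)) := by
      rw [← h.fderiv_cometricField_inr (hzΩ s hs), ← map_add, ← e1]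
    simp only [map_zero, add_zero, ContinuousLinearMap.comp_apply]
    refine e2.trans (Prod.ext ?_ ?_)
    · rw [Prod.fst_add, h.fderiv_cometricField_inl_fst (hzΩ s hs)]
    · rw [Prod.snd_add]
      exact (sub_eq_add_neg _ _).symm
  have hy1 : ∀ s ∈ Icc 0 t, HasDerivAt (fun s => (y s).1) (A s (y s).1 + P s (y s).2) s :=
    fun s hs => (hy s hs).fst
  have hy0 : y 0 = (0, η) := by simp [y, hY0]
  have hzero := jacobi_fst_eq_zero (x := fun s => (y s).1) (ξ := fun s => (y s).2) (P := P)
    (A := A) (C := C) hK0.le htpos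
    (by
      have := ht.2.trans_le (min_le_right _ _)
      rw [lt_div_iff₀ (by positivity)] at this
      linarith)
    (fun s hs => h.symm _ (hzΩ s hs)) (fun s hs => h.nonneg _ (hzΩ s hs))
    (fun s hs => ContinuousLinearMap.opNorm_le_bound _ hK0.le fun ζ => by
      have := h.fderiv_cometricField_inr (hzΩ s hs) ζ
      calc ‖P s ζ‖ = ‖(fderiv ℝ (cometricField B) (z s) (0, ζ)).1‖ := by rw [this]
        _ ≤ _ := norm_fst_apply_inr_le _ _
        _ ≤ K * ‖ζ‖ := by gcongr; exact hDK s hs)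
    (fun s hs => ContinuousLinearMap.opNorm_le_bound _ hK0.le fun w => by
      calc ‖A s w‖ = ‖(fderiv ℝ (cometricField B) (z s) (w, 0)).1‖ := by
            rw [h.fderiv_cometricField_inl_fst (hzΩ s hs)]
        _ ≤ ‖fderiv ℝ (cometricField B) (z s) (w, 0)‖ := norm_fst_le _
        _ ≤ K * ‖(w, (0 : E →L[ℝ] ℝ))‖ := ContinuousLinearMap.le_of_opNorm_le _ (hDK s hs) _
        _ = K * ‖w‖ := by simp [Prod.norm_def])
    (fun s hs => ContinuousLinearMap.opNorm_le_bound _ hK0.le fun w => by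
      calc ‖C s w‖ = ‖(fderiv ℝ (cometricField B) (z s) (w, 0)).2‖ := rfl
        _ ≤ ‖fderiv ℝ (cometricField B) (z s) (w, 0)‖ := norm_snd_le _
        _ ≤ K * ‖(w, (0 : E →L[ℝ] ℝ))‖ := ContinuousLinearMap.le_of_opNorm_le _ (hDK s hs) _
        _ = K * ‖w‖ := by simp [Prod.norm_def])
    hy1 (fun s hs => (hy s hs).snd) (by simp [hy0]) hη'
  -- As y vanishes on [0, t], so does its derivative A y + P η, which leaves P η = 0.
  have hker : ∀ s ∈ Icc 0 t, P s (y s).2 = 0 := by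
    intro s hs
    have := UniqueDiffWithinAt.eq_deriv _ (uniqueDiffOn_Icc htpos s hs)
      (hy1 s hs).hasDerivWithinAt
      ((hasDerivWithinAt_const s (Icc 0 t) (0 : E)).congr hzero (hzero s hs))
    simpa [hzero s hs] using this
  have h0mem : (0 : ℝ) ∈ Icc 0 t := left_mem_Icc.2 htpos.le
  have hz0 : z 0 = (x₀, ξ) := hZ0
  have hfin := h.jacobi_snd_eq_zero (x := fun s => (z s).1) (η := fun s => (y s).2) htpos hBξ
    (by simp [hz0]) hzΩ
    (by
      have := (hZt 0 (hsub 0 h0mem)).2.1.fst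
      rw [hZ0] at this
      exact this)
    (by
      have : HasDerivAt (fun s => (y s).2) (C 0 (y 0).1 - (y 0).2.comp (A 0)) 0 :=
        (hy 0 h0mem).snd
      refine this.congr_deriv ?_
      simp [A, hz0, hy0])
    hker
  simpa [hy0] using hfin

end LocalExponential

/-! ### Nondegeneracy from the contact condition -/

section Wedge

variable {E : Type*} [AddCommGroup E] [Module ℝ E]

theorem Fin.eq_zero_or_odd_or_even {n : ℕ} (i : Fin (2 * n + 1)) :
    i = 0 ∨ (∃ k : Fin n, i = ⟨2 * (k : ℕ) + 1, by omega⟩) ∨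
      ∃ k : Fin n, i = ⟨2 * (k : ℕ) + 2, by omega⟩ := by
  obtain ⟨i, hi⟩ := i
  rcases Nat.eq_zero_or_pos i with h | h
  · exact Or.inl (Fin.ext h)
  rcases Nat.even_or_odd i with ⟨m, hm⟩ | ⟨m, hm⟩
  · exact Or.inr (Or.inr ⟨⟨m - 1, by omega⟩, Fin.ext (by simp; omega)⟩)
  · exact Or.inr (Or.inl ⟨⟨m, by omega⟩, Fin.ext (by simp; omega)⟩)

/-- The multilinear map `a(v₀) b(v₁, v₂) ⋯ b(v₂ₙ₋₁, v₂ₙ)`, whose alternatization is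
`wedgePow`. -/
noncomputable def wedgeTerm (n : ℕ) (a : E →ₗ[ℝ] ℝ) (b : E →ₗ[ℝ] E →ₗ[ℝ] ℝ) :
    MultilinearMap ℝ (fun _ : Fin (2 * n + 1) => E) ℝ :=
  -- Each slot occurs in exactly one factor, so the product is linear in it; this one fact yields
  -- both additivity and homogeneity.
  have key : ∀ [DecidableEq (Fin (2 * n + 1))] (w : Fin (2 * n + 1) → E) (i : Fin (2 * n + 1)),
      ∃ L : E →ₗ[ℝ] ℝ, ∀ x, a (Function.update w i x 0) *
        ∏ k : Fin n, b (Function.update w i x ⟨2 * (k : ℕ) + 1, by omega⟩)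
          (Function.update w i x ⟨2 * (k : ℕ) + 2, by omega⟩) = L x := by
    intro _ w i
    rcases Fin.eq_zero_or_odd_or_even i with rfl | ⟨k, rfl⟩ | ⟨k, rfl⟩
    · refine ⟨(∏ k : Fin n, b (w ⟨2 * (k : ℕ) + 1, by omega⟩)
        (w ⟨2 * (k : ℕ) + 2, by omega⟩)) • a, fun x => ?_⟩
      simp only [Function.update_self, LinearMap.smul_apply, smul_eq_mul]
      rw [mul_comm]
      congr 1
      refine Finset.prod_congr rfl fun k _ => ?_
      rw [Function.update_of_ne (by simp [Fin.ext_iff]),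
        Function.update_of_ne (by simp [Fin.ext_iff])]
    · refine ⟨(a (w 0) * ∏ j ∈ Finset.univ.erase k, b (w ⟨2 * (j : ℕ) + 1, by omega⟩)
        (w ⟨2 * (j : ℕ) + 2, by omega⟩)) • b.flip (w ⟨2 * (k : ℕ) + 2, by omega⟩), fun x => ?_⟩
      rw [← Finset.mul_prod_erase _ _ (Finset.mem_univ k), Function.update_self,
        Function.update_of_ne (by simp [Fin.ext_iff]),
        Function.update_of_ne (by simp [Fin.ext_iff]), Finset.prod_congr rfl fun j hj => ?_]
      · simp only [LinearMap.smul_apply, LinearMap.flip_apply, smul_eq_mul]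
        ring
      · have hjk : (j : ℕ) ≠ k := fun h => (Finset.mem_erase.1 hj).1 (Fin.ext h)
        rw [Function.update_of_ne (by simp [Fin.ext_iff, hjk]),
          Function.update_of_ne (by simp [Fin.ext_iff]; omega)]
    · refine ⟨(a (w 0) * ∏ j ∈ Finset.univ.erase k, b (w ⟨2 * (j : ℕ) + 1, by omega⟩)
        (w ⟨2 * (j : ℕ) + 2, by omega⟩)) • b (w ⟨2 * (k : ℕ) + 1, by omega⟩), fun x => ?_⟩
      rw [← Finset.mul_prod_erase _ _ (Finset.mem_univ k), Function.update_self,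
        Function.update_of_ne (by simp [Fin.ext_iff]),
        Function.update_of_ne (by simp [Fin.ext_iff]), Finset.prod_congr rfl fun j hj => ?_]
      · simp only [LinearMap.smul_apply, smul_eq_mul]
        ring
      · have hjk : (j : ℕ) ≠ k := fun h => (Finset.mem_erase.1 hj).1 (Fin.ext h)
        rw [Function.update_of_ne (by simp [Fin.ext_iff]; omega),
          Function.update_of_ne (by simp [Fin.ext_iff, hjk])]
  { toFun := fun w => a (w 0) * ∏ k : Fin n, b (w ⟨2 * (k : ℕ) + 1, by omega⟩)
      (w ⟨2 * (k : ℕ) + 2, by omega⟩)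
    map_update_add' := fun w i x y => by
      obtain ⟨L, hL⟩ := key w i
      rw [hL, hL, hL, map_add]
    map_update_smul' := fun w i c x => by
      obtain ⟨L, hL⟩ := key w i
      rw [hL, hL, map_smul] }

/-- An alternating form vanishes as soon as it does on injective tuples of basis vectors, so the
basis can be adapted to the hyperplane. -/
theorem wedgePow_eq_alternatization (n : ℕ) (a : E →ₗ[ℝ] ℝ) (b : E →ₗ[ℝ] E →ₗ[ℝ] ℝ)
    (w : Fin (2 * n + 1) → E) : wedgePow n a (fun u v => b u v) w =
      MultilinearMap.alternatization (wedgeTerm n a b) w := by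
  rw [MultilinearMap.alternatization_apply]
  refine Finset.sum_congr rfl fun σ _ => ?_
  rw [Units.smul_def, zsmul_eq_mul]
  rfl

/-- A nonzero vector of a hyperplane is a member of a basis whose other vectors, but the first
one, lie in the hyperplane. -/
theorem exists_basis_adapted {d : ℕ} (hd : Module.finrank ℝ E = d + 1) {a : E →ₗ[ℝ] ℝ}
    (ha : a ≠ 0) {v : E} (hv : v ≠ 0) (hav : a v = 0) :
    ∃ e : Module.Basis (Fin (d + 1)) ℝ E, (∀ i, i ≠ 0 → a (e i) = 0) ∧ ∃ j ≠ 0, e j = v := by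
  have hfd : FiniteDimensional ℝ E := Module.finite_of_finrank_pos (by omega)
  obtain ⟨r, hr⟩ : ∃ r, a r ≠ 0 := by
    by_contra! hc
    exact ha (LinearMap.ext hc)
  let v' : LinearMap.ker a := ⟨v, hav⟩
  have hv' : v' ≠ 0 := fun h => hv (congrArg Subtype.val h)
  have hli : LinearIndepOn ℝ id {v'} := LinearIndepOn.singleton (by simpa using hv')
  let bs := Module.Basis.extend hli
  have hmem : v' ∈ hli.extend (subset_univ _) := hli.subset_extend _ (mem_singleton v')
  have hker : Module.finrank ℝ (LinearMap.ker a) = d := by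
    have h1 := LinearMap.finrank_range_add_finrank_ker a
    have h2 : LinearMap.range a = ⊤ := LinearMap.range_eq_top.2 (LinearMap.surjective ha)
    rw [h2, finrank_top, Module.finrank_self] at h1
    omega
  have := FiniteDimensional.fintypeBasisIndex bs
  let eq := Fintype.equivFinOfCardEq ((Module.finrank_eq_card_basis bs).symm.trans hker)
  let bk := bs.reindex eq
  let e := Module.Basis.mkFinCons r bk
    (fun c x hx hc => by
      have := congrArg a hc
      simp only [map_add, map_smul, LinearMap.mem_ker.1 hx, map_zero, add_zero, smul_eq_mul,
        mul_eq_zero] at this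
      exact this.resolve_right hr)
    (fun z => ⟨-(a z / a r), by simp [LinearMap.mem_ker, hr]⟩)
  refine ⟨e, fun i hi => ?_, (eq ⟨v', hmem⟩).succ, Fin.succ_ne_zero _, ?_⟩
  · obtain ⟨k, rfl⟩ := Fin.exists_succ_eq.2 hi
    simp [e]
  · simp [e, bk, bs, v']

/-- If `a ∧ bⁿ ≠ 0` on a space of dimension `2n+1`, then `b` is nondegenerate on the kernel
of `a`. -/
theorem exists_ne_zero_of_wedgePow_ne_zero {n : ℕ} (hd : Module.finrank ℝ E = 2 * n + 1)
    {a : E →ₗ[ℝ] ℝ} {b : E →ₗ[ℝ] E →ₗ[ℝ] ℝ} (hb : ∀ u v, b u v = -b v u)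
    {w : Fin (2 * n + 1) → E} (hw : wedgePow n a (fun u v => b u v) w ≠ 0) {v : E} (hv : v ≠ 0)
    (hav : a v = 0) : ∃ u, a u = 0 ∧ b v u ≠ 0 := by
  by_contra! hc
  have ha : a ≠ 0 := by
    rintro rfl
    exact hw (by simp [wedgePow])
  obtain ⟨e, he, j, hj0, hj⟩ := exists_basis_adapted hd ha hv hav
  refine hw ?_
  rw [wedgePow_eq_alternatization]
  suffices h : MultilinearMap.alternatization (wedgeTerm n a b) = 0 by rw [h]; rfl
  refine Module.Basis.ext_alternating e fun τ hτ => ?_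
  rw [← wedgePow_eq_alternatization]
  refine Finset.sum_eq_zero fun σ _ => ?_
  have hinj : Function.Injective (τ ∘ σ) := hτ.comp σ.injective
  obtain ⟨m, hm⟩ := (Finite.injective_iff_surjective.1 hinj) j
  -- If the first slot does not hold the transverse basis vector, a kills the term. Otherwise all
  -- the other slots lie in ker a and one of them is v, whose b-pairing with its partner vanishes.
  by_cases h0 : τ (σ 0) = 0
  · have hne : ∀ k : Fin (2 * n + 1), k ≠ 0 → a (e (τ (σ k))) = 0 := fun k hk =>
      he _ fun h => hk (hinj (h.trans h0.symm))
    have hm' : e (τ (σ m)) = v := by rw [← hj, ← hm]; rfl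
    have hprod : ∏ i : Fin n, b ((e ∘ τ) (σ ⟨2 * (i : ℕ) + 1, by omega⟩))
        ((e ∘ τ) (σ ⟨2 * (i : ℕ) + 2, by omega⟩)) = 0 := by
      rcases Fin.eq_zero_or_odd_or_even m with rfl | ⟨k, rfl⟩ | ⟨k, rfl⟩
      · exact absurd (hm.symm.trans h0) hj0
      · refine Finset.prod_eq_zero (Finset.mem_univ k) ?_
        simp only [Function.comp_apply, hm']
        exact hc _ (hne _ (by simp [Fin.ext_iff]))
      · refine Finset.prod_eq_zero (Finset.mem_univ k) ?_
        simp only [Function.comp_apply, hm']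
        rw [hb, hc _ (hne _ (by simp [Fin.ext_iff])), neg_zero]
    exact mul_eq_zero_of_right _ (mul_eq_zero_of_right _ hprod)
  · simp [he _ h0]

end Wedge

/-! ### Cometrics built from a frame -/

section Frame

variable {E : Type*} [NormedAddCommGroup E] [NormedSpace ℝ E]

theorem contDiffOn_matrix_det {m : ℕ} {k : WithTop ℕ∞} {s : Set E}
    {M : E → Matrix (Fin m) (Fin m) ℝ} (hM : ∀ i j, ContDiffOn ℝ k (fun x => M x i j) s) :
    ContDiffOn ℝ k (fun x => (M x).det) s := by
  simp only [Matrix.det_apply']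
  exact ContDiffOn.sum fun σ _ => contDiffOn_const.mul (contDiffOn_prod fun i _ => hM _ _)

/-- Cramer's rule: the entries of the inverse are quotients of determinants. -/
theorem contDiffOn_matrix_inv_apply {m : ℕ} {k : WithTop ℕ∞} {s : Set E}
    {M : E → Matrix (Fin m) (Fin m) ℝ} (hM : ∀ i j, ContDiffOn ℝ k (fun x => M x i j) s)
    (hdet : ∀ x ∈ s, (M x).det ≠ 0) (i j : Fin m) :
    ContDiffOn ℝ k (fun x => (M x)⁻¹ i j) s := by
  simp only [Matrix.inv_def, Matrix.smul_apply, Matrix.adjugate_apply, Ring.inverse_eq_inv',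
    smul_eq_mul]
  refine ((contDiffOn_matrix_det hM).inv hdet).mul (contDiffOn_matrix_det fun a b => ?_)
  by_cases h : a = j
  · subst h
    simpa [Matrix.updateRow_apply] using contDiffOn_const
  · simpa [Matrix.updateRow_apply, h] using hM a b

/-- The cometric `η ↦ ∑ cᵢⱼ η(Xᵢ) Xⱼ`. -/
noncomputable def frameCometric {m : ℕ} (c : Matrix (Fin m) (Fin m) ℝ) (X : Fin m → E) :
    (E →L[ℝ] ℝ) →L[ℝ] E :=
  ∑ i, ∑ j, c i j • (ContinuousLinearMap.apply ℝ ℝ (X i)).smulRight (X j)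

variable {m : ℕ} {c : Matrix (Fin m) (Fin m) ℝ} {X : Fin m → E}

theorem frameCometric_apply (η : E →L[ℝ] ℝ) :
    frameCometric c X η = ∑ i, ∑ j, (c i j * η (X i)) • X j := by
  simp [frameCometric, smul_smul]

theorem apply_frameCometric (η ζ : E →L[ℝ] ℝ) :
    ζ (frameCometric c X η) = ∑ i, ∑ j, c i j * η (X i) * ζ (X j) := by
  simp [frameCometric_apply]

theorem frameCometric_symm (hc : c.PosDef) (η ζ : E →L[ℝ] ℝ) :
    η (frameCometric c X ζ) = ζ (frameCometric c X η) := by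
  rw [apply_frameCometric, apply_frameCometric, Finset.sum_comm]
  refine Finset.sum_congr rfl fun i _ => Finset.sum_congr rfl fun j _ => ?_
  have : c j i = c i j := by simpa using hc.isHermitian.apply i j
  rw [this]
  ring

theorem frameCometric_nonneg (hc : c.PosDef) (η : E →L[ℝ] ℝ) :
    0 ≤ η (frameCometric c X η) := by
  have := hc.posSemidef.dotProduct_mulVec_nonneg (fun i => η (X i))
  rw [apply_frameCometric]
  refine this.trans_eq ?_
  simp only [dotProduct, Matrix.mulVec, Finset.mul_sum]
  refine Finset.sum_congr rfl fun i _ => Finset.sum_congr rfl fun j _ => ?_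
  simp
  ring

/-- Independence of the frame makes every coefficient vanish, and the coefficient matrix is
invertible. The kernel of the cometric is thus the annihilator of the distribution. -/
theorem frameCometric_eq_zero_iff (hc : c.PosDef) (hX : LinearIndependent ℝ X)
    (η : E →L[ℝ] ℝ) : frameCometric c X η = 0 ↔ ∀ i, η (X i) = 0 := by
  refine ⟨fun h => ?_, fun h => by simp [frameCometric_apply, h]⟩
  rw [frameCometric_apply, Finset.sum_comm] at h
  simp only [← Finset.sum_smul] at h
  have h1 := Fintype.linearIndependent_iff.1 hX _ h
  have h2 : Matrix.vecMul (fun i => η (X i)) c = 0 := by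
    ext j
    simpa [Matrix.vecMul, dotProduct, mul_comm] using h1 j
  have h3 : Function.Injective (fun v => Matrix.vecMul v c) :=
    Matrix.vecMul_injective_iff_isUnit.2 hc.isUnit
  have h4 : (fun i => η (X i)) = 0 := h3 (by simpa using h2)
  exact fun i => congrFun h4 i

theorem ContDiffOn.frameCometric {s : Set E} {k : WithTop ℕ∞}
    {c : E → Matrix (Fin m) (Fin m) ℝ} {X : Fin m → E → E}
    (hc : ∀ i j, ContDiffOn ℝ k (fun x => c x i j) s) (hX : ∀ i, ContDiffOn ℝ k (X i) s) :
    ContDiffOn ℝ k (fun x => frameCometric (c x) fun i => X i x) s := by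
  unfold _root_.frameCometric
  refine ContDiffOn.sum fun i _ => ContDiffOn.sum fun j _ => (hc i j).smul ?_
  exact ((ContinuousLinearMap.contDiff (ContinuousLinearMap.apply ℝ ℝ)).comp_contDiffOn
    (hX i)).smulRight (hX j)

end Frame

/-! ### Derivatives of charts and vector fields read in charts -/

section ChartDeriv

variable {n : ℕ} {M : Type*} [TopologicalSpace M] [ChartedSpace (ContactModel n) M]

local notation "φ" => extChartAt (𝓡 (2 * n + 1))

/-- The derivative of the chart around `c` at the point `q`, as an endomorphism of the model. -/
noncomputable def chartDeriv (c q : M) : ContactModel n →L[ℝ] ContactModel n :=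
  mfderiv (𝓡 (2 * n + 1)) 𝓘(ℝ, ContactModel n) (φ c) q

/-- The derivative of the inverse of the chart around `c` at `x`, as an endomorphism of the
model. -/
noncomputable def chartSymmDeriv (c : M) (x : ContactModel n) :
    ContactModel n →L[ℝ] ContactModel n :=
  mfderiv 𝓘(ℝ, ContactModel n) (𝓡 (2 * n + 1)) (φ c).symm x

variable [IsManifold (𝓡 (2 * n + 1)) ∞ M]

theorem isManifold_one_of_infty : IsManifold (𝓡 (2 * n + 1)) 1 M :=
  IsManifold.of_le (n := ∞) (by simp)

theorem mdifferentiableAt_extChartAt_symm' {c : M} {x : ContactModel n} (hx : x ∈ (φ c).target) :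
    MDifferentiableAt 𝓘(ℝ, ContactModel n) (𝓡 (2 * n + 1)) (φ c).symm x :=
  have := isManifold_one_of_infty (n := n) (M := M)
  (mdifferentiableOn_extChartAt_symm x hx).mdifferentiableAt
    ((isOpen_extChartAt_target c).mem_nhds hx)

theorem mdifferentiableAt_extChartAt' {c q : M} (hq : q ∈ (φ c).source) :
    MDifferentiableAt (𝓡 (2 * n + 1)) 𝓘(ℝ, ContactModel n) (φ c) q :=
  have := isManifold_one_of_infty (n := n) (M := M)
  mdifferentiableAt_extChartAt (by simpa using hq)

/-- The derivative of a change of charts. -/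
theorem hasFDerivAt_transition {c c' : M} {x : ContactModel n} (hx : x ∈ (φ c).target)
    (hx' : (φ c).symm x ∈ (φ c').source) :
    HasFDerivAt (φ c' ∘ (φ c).symm)
      ((chartDeriv c' ((φ c).symm x)).comp (chartSymmDeriv c x)) x := by
  have h1 := (mdifferentiableAt_extChartAt' hx').hasMFDerivAt.comp x
    (mdifferentiableAt_extChartAt_symm' hx).hasMFDerivAt
  exact h1.hasFDerivAt

theorem chartDeriv_comp_chartSymmDeriv {c : M} {x : ContactModel n} (hx : x ∈ (φ c).target) :
    (chartDeriv c ((φ c).symm x)).comp (chartSymmDeriv c x) =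
      ContinuousLinearMap.id ℝ (ContactModel n) := by
  refine (hasFDerivAt_transition hx ((φ c).map_target hx)).unique
    ((hasFDerivAt_id x).congr_of_eventuallyEq ?_)
  filter_upwards [(isOpen_extChartAt_target c).mem_nhds hx] with y hy using (φ c).right_inv hy

/-- In finite dimension a one-sided inverse is two-sided. -/
theorem chartSymmDeriv_comp_chartDeriv {c : M} {x : ContactModel n} (hx : x ∈ (φ c).target) :
    (chartSymmDeriv c x).comp (chartDeriv c ((φ c).symm x)) =
      ContinuousLinearMap.id ℝ (ContactModel n) := by
  have h : (chartDeriv (n := n) c ((φ c).symm x) : ContactModel n →ₗ[ℝ] ContactModel n) *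
      (chartSymmDeriv (n := n) c x : ContactModel n →ₗ[ℝ] ContactModel n) = 1 := by
    ext1 v
    exact DFunLike.congr_fun (chartDeriv_comp_chartSymmDeriv hx) v
  ext1 v
  exact DFunLike.congr_fun (mul_eq_one_comm.1 h) v

end ChartDeriv

section FrameInChart

variable {n : ℕ} {M : Type*} [TopologicalSpace M] [ChartedSpace (ContactModel n) M]
  [IsManifold (𝓡 (2 * n + 1)) ∞ M]

local notation "φ" => extChartAt (𝓡 (2 * n + 1))

/-- The expression of a smooth vector field in a chart is smooth. -/
theorem contDiffOn_vectorField_inChart {U : Set M} (hU : IsOpen U)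
    {Y : ∀ q : M, TangentSpace (𝓡 (2 * n + 1)) q}
    (hY : ContMDiffOn (𝓡 (2 * n + 1)) (𝓡 (2 * n + 1)).tangent ∞
      (fun q : M => (⟨q, Y q⟩ : TangentBundle (𝓡 (2 * n + 1)) M)) U) (c : M) :
    ContDiffOn ℝ ∞ (fun x => chartDeriv c ((φ c).symm x) (Y ((φ c).symm x)))
      ((φ c).target ∩ (φ c).symm ⁻¹' U) := by
  have := isManifold_one_of_infty (n := n) (M := M)
  have h1 := ((trivializationAt (ContactModel n) (TangentSpace (𝓡 (2 * n + 1))) c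
    ).contMDiffOn_section_iff (IB := 𝓡 (2 * n + 1)) (n := ∞) (s := Y)
    (a := U ∩ (chartAt (ContactModel n) c).source)
    (hU.inter (chartAt (ContactModel n) c).open_source) (by simp)).1 (hY.mono inter_subset_left)
  have h2 : ContMDiffOn (𝓡 (2 * n + 1)) 𝓘(ℝ, ContactModel n) ∞
      (fun q => chartDeriv c q (Y q)) (U ∩ (chartAt (ContactModel n) c).source) := by
    refine h1.congr fun q hq => ?_
    have h3 := TangentBundle.continuousLinearMapAt_trivializationAt (𝕜 := ℝ)
      (I := 𝓡 (2 * n + 1)) hq.2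
    have h4 := congrArg (fun L => L (Y q)) h3
    refine h4.symm.trans ?_
    rw [Bundle.Trivialization.continuousLinearMapAt_apply_of_mem]
    simpa using hq.2
  rw [← contMDiffOn_iff_contDiffOn]
  refine h2.comp ((contMDiffOn_extChartAt_symm c).mono inter_subset_left) fun x hx => ⟨hx.2, ?_⟩
  simpa using (φ c).map_target hx.1

theorem contDiffOn_function_inChart {U : Set M} {f : M → ℝ}
    (hf : ContMDiffOn (𝓡 (2 * n + 1)) 𝓘(ℝ, ℝ) ∞ f U) (c : M) :
    ContDiffOn ℝ ∞ (fun x => f ((φ c).symm x)) ((φ c).target ∩ (φ c).symm ⁻¹' U) := by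
  rw [← contMDiffOn_iff_contDiffOn]
  exact hf.comp ((contMDiffOn_extChartAt_symm c).mono inter_subset_left) fun x hx => hx.2

end FrameInChart

/-! ### The Hamiltonian in terms of a frame -/

namespace ContactSubRiemannian

variable {n : ℕ} {M : Type*} [TopologicalSpace M] [ChartedSpace (ContactModel n) M]
  [IsManifold (𝓡 (2 * n + 1)) ∞ M]

local notation "φ" => extChartAt (𝓡 (2 * n + 1))

/-- If the vector `b` of the distribution represents the covector `p`, then `H(p) = 1/2 ⟨p, b⟩`. -/
theorem hamiltonian_eq_of_represents (S : ContactSubRiemannian n M) {q : M} {p : CotSpace n q}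
    {b : S.Δ q} (hb : ∀ v : S.Δ q, S.g q b v = p v) : S.hamiltonian q p = 1 / 2 * p b := by
  unfold hamiltonian
  congr 1
  have hnn : ∀ v : S.Δ q, 0 ≤ S.g q v v := fun v => by
    by_cases hv : v = 0
    · simp [hv]
    · exact (S.g_pos q v hv).le
  have hle : ∀ v : {v : S.Δ q // v ≠ 0}, p (v : S.Δ q) ^ 2 / S.g q v v ≤ p b := fun v => by
    have hcs := LinearMap.BilinForm.apply_mul_apply_le_of_forall_zero_le (S.g q) hnn b v
    rw [S.g_symm q v b, hb, hb] at hcs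
    rw [div_le_iff₀ (S.g_pos q v v.2), sq]
    exact hcs
  -- For b = 0 every quotient vanishes, and the supremum is 0 even over an empty index set. For b ≠
  -- 0 the Cauchy-Schwarz bound is attained at b.
  by_cases hb0 : b = 0
  · have h0 : ∀ v : {v : S.Δ q // v ≠ 0}, p (v : S.Δ q) ^ 2 / S.g q v v = 0 := fun v => by
      rw [← hb, hb0]; simp
    simp [h0, hb0]
  · have : Nonempty {v : S.Δ q // v ≠ 0} := ⟨⟨b, hb0⟩⟩
    refine le_antisymm (ciSup_le hle) ?_
    refine le_ciSup_of_le ⟨p b, by rintro _ ⟨v, rfl⟩; exact hle v⟩ ⟨b, hb0⟩ ?_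
    have hpos : 0 < p b := by rw [← hb]; exact S.g_pos q b hb0
    simp only [hb]
    rw [sq, mul_div_assoc, div_self hpos.ne', mul_one]

/-- The Gram matrix of a frame of the distribution. -/
noncomputable def gram (S : ContactSubRiemannian n M) {m : ℕ} (q : M) (Y : Fin m → S.Δ q) :
    Matrix (Fin m) (Fin m) ℝ :=
  Matrix.of fun i j => S.g q (Y i) (Y j)

theorem posDef_gram (S : ContactSubRiemannian n M) {m : ℕ} {q : M} {Y : Fin m → S.Δ q}
    (hY : LinearIndependent ℝ Y) : (S.gram q Y).PosDef := by
  refine Matrix.PosDef.of_dotProduct_mulVec_pos (Matrix.IsHermitian.ext fun i j => ?_) ?_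
  · simp [gram, S.g_symm q (Y j) (Y i)]
  · intro a ha
    have h1 : ∑ i, a i • Y i ≠ 0 := fun h =>
      ha (funext (Fintype.linearIndependent_iff.1 hY a h))
    refine (S.g_pos q _ h1).trans_eq ?_
    simp only [map_sum, map_smul, LinearMap.sum_apply, LinearMap.smul_apply, smul_eq_mul,
      dotProduct, Matrix.mulVec, gram, Finset.mul_sum, Pi.star_apply, star_trivial,
      Matrix.of_apply]
    rw [Finset.sum_comm]
    exact Finset.sum_congr rfl fun i _ => Finset.sum_congr rfl fun j _ => by ring

/-- The inverse Gram matrix gives the coefficients of the vector of Δ that represents p through g.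
-/
theorem hamiltonian_eq_frame (S : ContactSubRiemannian n M) {m : ℕ} {q : M} {Y : Fin m → S.Δ q}
    (hY : LinearIndependent ℝ Y) (hspan : Submodule.span ℝ (range Y) = ⊤) (p : CotSpace n q) :
    S.hamiltonian q p = 1 / 2 * ∑ i, ∑ j, (S.gram q Y)⁻¹ i j * p (Y i) * p (Y j) := by
  have hunit : IsUnit (S.gram q Y).det := (Matrix.isUnit_iff_isUnit_det _).1 (S.posDef_gram hY).isUnit
  let b : S.Δ q := ∑ i, ∑ j, ((S.gram q Y)⁻¹ i j * p (Y i)) • Y j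
  have hb : ∀ v : S.Δ q, S.g q b v = p v := by
    suffices h : S.g q b = (p : _ →ₗ[ℝ] ℝ).comp (S.Δ q).subtype from fun v => by rw [h]; rfl
    refine LinearMap.ext_on_range hspan fun k => ?_
    have h1 : ∀ i, ∑ j, (S.gram q Y)⁻¹ i j * S.g q (Y j) (Y k) = if i = k then 1 else 0 := by
      intro i
      have := congrFun (congrFun (Matrix.nonsing_inv_mul _ hunit) i) k
      rw [Matrix.mul_apply, Matrix.one_apply] at this
      exact this
    calc S.g q b (Y k) = ∑ i, p (Y i) * ∑ j, (S.gram q Y)⁻¹ i j * S.g q (Y j) (Y k) := by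
          simp only [b, map_sum, map_smul, LinearMap.sum_apply, LinearMap.smul_apply,
            smul_eq_mul, Finset.mul_sum]
          refine Finset.sum_congr rfl fun i _ => Finset.sum_congr rfl fun j _ => by ring
      _ = p (Y k) := by simp [h1]
  rw [S.hamiltonian_eq_of_represents hb]
  simp [b]

end ContactSubRiemannian

/-! ### The contact structure read in a chart -/

namespace ContactSubRiemannian

variable {n : ℕ} {M : Type*} [TopologicalSpace M] [ChartedSpace (ContactModel n) M]
  [IsManifold (𝓡 (2 * n + 1)) ∞ M]

local notation "φ" => extChartAt (𝓡 (2 * n + 1))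

/-- The distribution at `q`, read in the chart around `c`. -/
noncomputable def distribInChart (S : ContactSubRiemannian n M) (c q : M) :
    S.Δ q →ₗ[ℝ] ContactModel n where
  toFun v := chartDeriv c q v.1
  map_add' v w := (chartDeriv c q).map_add v.1 w.1
  map_smul' a v := (chartDeriv c q).map_smul a v.1

theorem chartSymmDeriv_distribInChart (S : ContactSubRiemannian n M) {c : M} {x : ContactModel n}
    (hx : x ∈ (φ c).target) (v : S.Δ ((φ c).symm x)) :
    chartSymmDeriv c x (S.distribInChart c ((φ c).symm x) v) = v.1 :=
  DFunLike.congr_fun (chartSymmDeriv_comp_chartDeriv hx) _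

theorem distribInChart_injective (S : ContactSubRiemannian n M) {c : M} {x : ContactModel n}
    (hx : x ∈ (φ c).target) : Function.Injective (S.distribInChart c ((φ c).symm x)) := by
  intro v w h
  have h1 := congrArg (chartSymmDeriv c x) h
  rw [S.chartSymmDeriv_distribInChart hx, S.chartSymmDeriv_distribInChart hx] at h1
  exact Subtype.ext h1

theorem form_apply_distribInChart (S : ContactSubRiemannian n M) {θ : ∀ q : M, CotSpace n q}
    {c : M} {x : ContactModel n} (hx : x ∈ (φ c).target)
    (hθ : ∀ v, v ∈ S.Δ ((φ c).symm x) ↔ θ ((φ c).symm x) v = 0) (v : S.Δ ((φ c).symm x)) :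
    oneFormInChart θ c x (S.distribInChart c ((φ c).symm x) v) = 0 := by
  have h : oneFormInChart θ c x (S.distribInChart c ((φ c).symm x) v) = θ ((φ c).symm x) v :=
    congrArg (θ ((φ c).symm x)) (S.chartSymmDeriv_distribInChart hx v)
  rw [h]
  exact (hθ v).1 v.2

theorem exists_distribInChart_eq (S : ContactSubRiemannian n M) {θ : ∀ q : M, CotSpace n q}
    {c : M} {x : ContactModel n} (hx : x ∈ (φ c).target)
    (hθ : ∀ v, v ∈ S.Δ ((φ c).symm x) ↔ θ ((φ c).symm x) v = 0) {u : ContactModel n}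
    (hu : oneFormInChart θ c x u = 0) :
    ∃ v : S.Δ ((φ c).symm x), S.distribInChart c ((φ c).symm x) v = u :=
  ⟨⟨chartSymmDeriv c x u, (hθ _).2 hu⟩, DFunLike.congr_fun (chartDeriv_comp_chartSymmDeriv (n := n) hx) u⟩

theorem oneFormInChart_extChartAt (θ : ∀ q : M, CotSpace n q) {c q : M} (hq : q ∈ (φ c).source)
    (v : TangentSpace (𝓡 (2 * n + 1)) q) :
    oneFormInChart θ c (φ c q) (chartDeriv c q v) = θ q v := by
  have h1 : (show ContactModel n →L[ℝ] ℝ from θ ((φ c).symm (φ c q))) = θ q :=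
    congrArg (fun q' => (show ContactModel n →L[ℝ] ℝ from θ q')) ((φ c).left_inv hq)
  have h2 := chartSymmDeriv_comp_chartDeriv ((φ c).map_source hq)
  rw [(φ c).left_inv hq] at h2
  calc oneFormInChart θ c (φ c q) (chartDeriv c q v)
      = (show ContactModel n →L[ℝ] ℝ from θ ((φ c).symm (φ c q)))
          ((chartSymmDeriv c (φ c q)).comp (chartDeriv c q) v) := rfl
    _ = θ q v := by rw [h1, h2]; rfl

/-- In a chart, a contact sub-Riemannian structure is given by a contact cometric. -/
theorem exists_isContactCometric (S : ContactSubRiemannian n M) (q₀ : M) :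
    ∃ (B : ContactModel n → (ContactModel n →L[ℝ] ℝ) →L[ℝ] ContactModel n)
      (θ : ContactModel n → ContactModel n →L[ℝ] ℝ) (Ω : Set (ContactModel n)),
      IsContactCometric B θ Ω (φ q₀ q₀) ∧ Ω ⊆ (φ q₀).target ∧
      (∀ x ∈ Ω, ∀ ξ, S.hamiltonianInChart q₀ x ξ = 1 / 2 * ξ (B x ξ)) ∧
      ∀ v : TangentSpace (𝓡 (2 * n + 1)) q₀,
        v ∈ S.Δ q₀ ↔ θ (φ q₀ q₀) (chartDeriv q₀ q₀ v) = 0 := by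
  obtain ⟨U, hU, hqU, Y, hYs, hYb, hYg⟩ := S.smooth q₀
  obtain ⟨U', hU', hqU', θ, hθs, hθ⟩ := S.contact q₀
  set Ω : Set (ContactModel n) := (φ q₀).target ∩ (φ q₀).symm ⁻¹' (U ∩ U') with hΩ
  have hopen : ∀ {V : Set M}, IsOpen V → IsOpen ((φ q₀).target ∩ (φ q₀).symm ⁻¹' V) :=
    fun hV => (continuousOn_extChartAt_symm q₀).isOpen_inter_preimage
      (isOpen_extChartAt_target q₀) hV
  have hΩo : IsOpen Ω := hopen (hU.inter hU')
  have hx₀ : φ q₀ q₀ ∈ Ω := by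
    refine ⟨mem_extChartAt_target q₀, ?_⟩
    rw [mem_preimage, extChartAt_to_inv]
    exact ⟨hqU, hqU'⟩
  let c : ContactModel n → Matrix (Fin (2 * n)) (Fin (2 * n)) ℝ := fun x =>
    S.gram ((φ q₀).symm x) fun i => Y i ((φ q₀).symm x)
  let X : Fin (2 * n) → ContactModel n → ContactModel n := fun i x =>
    S.distribInChart q₀ ((φ q₀).symm x) (Y i ((φ q₀).symm x))
  have hc : ∀ x ∈ Ω, (c x).PosDef := fun x hx => S.posDef_gram (hYb _ hx.2.1).1
  have hX : ∀ x ∈ Ω, LinearIndependent ℝ fun i => X i x := fun x hx =>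
    (hYb _ hx.2.1).1.map' _ (LinearMap.ker_eq_bot.2 (S.distribInChart_injective hx.1))
  have hker : ∀ x ∈ Ω, ∀ η : ContactModel n →L[ℝ] ℝ,
      frameCometric (c x)⁻¹ (fun i => X i x) η = 0 ↔ ∀ i, η (X i x) = 0 := fun x hx =>
    frameCometric_eq_zero_iff (hc x hx).inv (hX x hx)
  have hd : Module.finrank ℝ (ContactModel n) = 2 * n + 1 := finrank_euclideanSpace_fin
  obtain ⟨w, hw⟩ := (hθ q₀ hqU').2
  let b : ContactModel n →ₗ[ℝ] ContactModel n →ₗ[ℝ] ℝ :=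
    LinearMap.mk₂ ℝ (dOneForm (oneFormInChart θ q₀) (φ q₀ q₀))
      (fun u u' v => by simp [dOneForm]; ring) (fun a u v => by simp [dOneForm]; ring)
      (fun u v v' => by simp [dOneForm]; ring) (fun a u v => by simp [dOneForm]; ring)
  have hw' : wedgePow n (oneFormInChart θ q₀ (φ q₀ q₀) : ContactModel n →ₗ[ℝ] ℝ)
      (fun u v => b u v) w ≠ 0 := hw
  refine ⟨fun x => frameCometric (c x)⁻¹ fun i => X i x, oneFormInChart θ q₀, Ω, ?_,
    inter_subset_left, ?_, fun v => ?_⟩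
  · refine
    { isOpen := hΩo
      mem := hx₀
      contDiffOn := ?_
      symm := fun x hx η ζ => frameCometric_symm (hc x hx).inv η ζ
      nonneg := fun x hx η => frameCometric_nonneg (hc x hx).inv η
      apply_form := fun x hx => (hker x hx _).2 fun i =>
        S.form_apply_distribInChart hx.1 (hθ _ hx.2.2).1 _
      eq_smul := fun x hx η hη => ?_
      form_ne := fun h0 => hw (by rw [h0]; simp [wedgePow])
      differentiableAt := ?_
      nondegenerate := fun v hv hav => ?_ }
    · refine ContDiffOn.frameCometric (contDiffOn_matrix_inv_apply (M := c) (fun i j => ?_)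
        fun x hx => (hc x hx).det_pos.ne') fun i => ?_
      · exact (contDiffOn_function_inChart (hYg i j) q₀).mono fun x hx => ⟨hx.1, hx.2.1⟩
      · exact (contDiffOn_vectorField_inChart hU (hYs i) q₀).mono fun x hx => ⟨hx.1, hx.2.1⟩
    · have hη' : ∀ u, oneFormInChart θ q₀ x u = 0 → η u = 0 := by
        intro u hu
        obtain ⟨v, rfl⟩ := S.exists_distribInChart_eq hx.1 (hθ _ hx.2.2).1 hu
        have h1 : (η : ContactModel n →ₗ[ℝ] ℝ).comp (S.distribInChart q₀ _) = 0 :=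
          LinearMap.ext_on_range (hYb _ hx.2.1).2 fun i => (hker x hx η).1 hη i
        exact DFunLike.congr_fun h1 v
      -- Away from the base point θ in this chart is not known to be nonzero here; if it vanishes at
      -- x, then η vanishes on everything and any factor serves.
      by_cases h0 : ∃ r, oneFormInChart θ q₀ x r ≠ 0
      · obtain ⟨r, hr⟩ := h0
        refine ⟨η r / oneFormInChart θ q₀ x r, ContinuousLinearMap.ext fun u => ?_⟩
        have := hη' (u - (oneFormInChart θ q₀ x u / oneFormInChart θ q₀ x r) • r) (by simp [hr])
        rw [map_sub, map_smul, sub_eq_zero] at this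
        rw [this]
        simp
        ring
      · push Not at h0
        exact ⟨0, ContinuousLinearMap.ext fun u => by simpa using hη' u (h0 u)⟩
    · refine ((hθs q₀).contDiffAt ((hopen hU').mem_nhds ⟨hx₀.1, hx₀.2.2⟩)).differentiableAt ?_
      simp
    · exact exists_ne_zero_of_wedgePow_ne_zero hd (b := b)
        (fun u v => by simp [b, dOneForm]) hw' hv hav
  · intro x hx ξ
    rw [apply_frameCometric]
    exact S.hamiltonian_eq_frame (hYb _ hx.2.1).1 (hYb _ hx.2.1).2 (covectorOfChart q₀ x ξ)
  · rw [oneFormInChart_extChartAt θ (mem_extChartAt_source q₀)]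
    exact (hθ q₀ hqU').1 v

end ContactSubRiemannian

/-! ### Invariance of Hamilton's equations -/

section ChangeOfCoordinates

variable {E : Type*} [NormedAddCommGroup E] [NormedSpace ℝ E]

/-- Extremals are defined by partial derivatives of H, while a change of canonical coordinates mixes
positions and momenta; the joint derivative links the two. -/
theorem IsContactCometric.hasFDerivAt_hamiltonian {B : E → (E →L[ℝ] ℝ) →L[ℝ] E}
    {θ : E → E →L[ℝ] ℝ} {Ω : Set E} {x₀ : E} (h : IsContactCometric B θ Ω x₀)
    {H : E → (E →L[ℝ] ℝ) → ℝ} (hH : ∀ x ∈ Ω, ∀ ξ, H x ξ = 1 / 2 * ξ (B x ξ))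
    {z : E × (E →L[ℝ] ℝ)} (hz : z.1 ∈ Ω) :
    ∃ L : E × (E →L[ℝ] ℝ) →L[ℝ] ℝ, HasFDerivAt (fun z : E × (E →L[ℝ] ℝ) => H z.1 z.2) L z ∧
      (∀ a, L (0, a) = a (cometricField B z).1) ∧ ∀ u, L (u, 0) = -(cometricField B z).2 u := by
  have h1 : HasFDerivAt (fun y : E × (E →L[ℝ] ℝ) => B y.1 y.2) _ z :=
    ((h.hasFDerivAt hz).comp z hasFDerivAt_fst).clm_apply hasFDerivAt_snd
  have h2 := (hasFDerivAt_snd.clm_apply h1).const_mul (1 / 2 : ℝ)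
  refine ⟨_, h2.congr_of_eventuallyEq ?_, fun a => ?_, fun u => ?_⟩
  · filter_upwards [continuousAt_fst.preimage_mem_nhds (h.isOpen.mem_nhds hz)] with y hy
      using hH _ hy _
  · have := h.symm z.1 hz z.2 a
    simp [cometricField, this]
    ring
  · simp [cometricField]

/-- Hamilton's equations are invariant under changes of coordinates. -/
theorem hamilton_change_coordinates {H₀ H₁ : E → (E →L[ℝ] ℝ) → ℝ} {ψ κ : E → E} {x : ℝ → E}
    {ξ : ℝ → E →L[ℝ] ℝ} {I : Set ℝ} {t : ℝ} {v : E} {α : E →L[ℝ] ℝ}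
    (hψ : ContDiffAt ℝ 2 ψ (x t)) (hκ : ContDiffAt ℝ 2 κ (ψ (x t)))
    (hψκ : ∀ᶠ y in 𝓝 (ψ (x t)), ψ (κ y) = y) (hκψ : ∀ᶠ y in 𝓝 (x t), κ (ψ y) = y)
    (hH : ∀ᶠ y in 𝓝 (ψ (x t)), ∀ η : E →L[ℝ] ℝ, H₁ y η = H₀ (κ y) (η.comp (fderiv ℝ ψ (κ y))))
    {L : E × (E →L[ℝ] ℝ) →L[ℝ] ℝ}
    (hL : HasFDerivAt (fun z : E × (E →L[ℝ] ℝ) => H₀ z.1 z.2) L (x t, ξ t))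
    (hLv : ∀ a, L (0, a) = a v) (hLα : ∀ u, L (u, 0) = -α u)
    (hx : HasDerivWithinAt x v I t) (hξ : HasDerivWithinAt ξ α I t) :
    (∀ a : E →L[ℝ] ℝ, HasDerivWithinAt (fun s => a (ψ (x s)))
      (fderiv ℝ (fun η => H₁ (ψ (x t)) η) ((ξ t).comp (fderiv ℝ κ (ψ (x t)))) a) I t) ∧
    ∀ u : E, HasDerivWithinAt (fun s => (ξ s).comp (fderiv ℝ κ (ψ (x s))) u)
      (-(fderiv ℝ (fun y => H₁ y ((ξ t).comp (fderiv ℝ κ (ψ (x t))))) (ψ (x t)) u)) I t := by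
  set P := fderiv ℝ ψ (x t) with hP
  set K := fderiv ℝ κ (ψ (x t)) with hK
  have hxt : κ (ψ (x t)) = x t := hκψ.self_of_nhds
  have hψd : HasFDerivAt ψ P (x t) := (hψ.differentiableAt (by simp)).hasFDerivAt
  have hψd' : HasFDerivAt ψ P (κ (ψ (x t))) := by rw [hxt]; exact hψd
  have hκd : HasFDerivAt κ K (ψ (x t)) := (hκ.differentiableAt (by simp)).hasFDerivAt
  have hKP : ∀ w, K (P w) = w := fun w => by
    have := (hκd.comp (x t) hψd).unique ((hasFDerivAt_id (x t)).congr_of_eventuallyEq hκψ)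
    exact DFunLike.congr_fun this w
  have hξKP : ((ξ t).comp K).comp P = ξ t := by
    ext w
    simp [hKP]
  -- second derivatives
  have hψ2 : DifferentiableAt ℝ (fderiv ℝ ψ) (x t) :=
    (hψ.fderiv_right (m := 1) (by norm_num)).differentiableAt (by simp)
  have hκ2 : DifferentiableAt ℝ (fderiv ℝ κ) (ψ (x t)) :=
    (hκ.fderiv_right (m := 1) (by norm_num)).differentiableAt (by simp)
  set P2 := fderiv ℝ (fderiv ℝ ψ) (x t) with hP2
  set K2 := fderiv ℝ (fderiv ℝ κ) (ψ (x t)) with hK2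
  have hsymm : ∀ u w, K2 u w = K2 w u := fun u w =>
    (hκ.isSymmSndFDerivAt (by simp [minSmoothness_of_isRCLikeNormedField])) u w
  have hψ2' : HasFDerivAt (fun y => fderiv ℝ ψ (κ y)) (P2.comp K) (ψ (x t)) := by
    have : HasFDerivAt (fderiv ℝ ψ) P2 (κ (ψ (x t))) := by rw [hxt]; exact hψ2.hasFDerivAt
    exact this.comp _ hκd
  -- The derivative of the identity Dψ(κ y) ∘ Dκ(y) = id.
  have hrel : ∀ u w, P2 (K u) (K w) + P (K2 u w) = 0 := by
    intro u w
    have hid : ∀ᶠ y in 𝓝 (ψ (x t)),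
        (fderiv ℝ ψ (κ y)).comp (fderiv ℝ κ y) = ContinuousLinearMap.id ℝ E := by
      have e1 : ∀ᶠ y in 𝓝 (ψ (x t)), DifferentiableAt ℝ κ y :=
        ((hκ.of_le (m := 1) (by norm_num)).eventually (by simp)).mono
          fun y hy => hy.differentiableAt (by simp)
      have e2 : ∀ᶠ y in 𝓝 (ψ (x t)), DifferentiableAt ℝ ψ (κ y) := by
        have : ∀ᶠ y in 𝓝 (κ (ψ (x t))), DifferentiableAt ℝ ψ y := by
          rw [hxt]
          exact ((hψ.of_le (m := 1) (by norm_num)).eventually (by simp)).mono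
            fun y hy => hy.differentiableAt (by simp)
        exact hκd.continuousAt.eventually this
      filter_upwards [e1, e2, hψκ.eventually_nhds] with y h1 h2 h3
      exact (h2.hasFDerivAt.comp y h1.hasFDerivAt).unique
        ((hasFDerivAt_id y).congr_of_eventuallyEq h3)
    have h1 := (hψ2'.clm_comp hκ2.hasFDerivAt).unique
      ((hasFDerivAt_const (ContinuousLinearMap.id ℝ E) (ψ (x t))).congr_of_eventuallyEq hid)
    have h2 := congrArg (fun T : E →L[ℝ] E →L[ℝ] E => T u w) h1
    simp [hxt] at h2
    rw [add_comm]
    exact h2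
  refine ⟨fun a => ?_, fun u => ?_⟩
  · have h1 : HasFDerivAt (fun η => H₁ (ψ (x t)) η)
        (L.comp ((ContinuousLinearMap.inr ℝ E (E →L[ℝ] ℝ)).comp
          ((ContinuousLinearMap.compL ℝ E E ℝ).flip P))) ((ξ t).comp K) := by
      have e1 : (fun η => H₁ (ψ (x t)) η) = fun η => H₀ (x t) (η.comp P) := by
        funext η
        rw [hH.self_of_nhds, hxt]
      rw [e1]
      have e2 : HasFDerivAt (fun η : E →L[ℝ] ℝ => (x t, η.comp P))
          ((ContinuousLinearMap.inr ℝ E (E →L[ℝ] ℝ)).comp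
          ((ContinuousLinearMap.compL ℝ E E ℝ).flip P)) ((ξ t).comp K) :=
        ((hasFDerivAt_prodMk_right (𝕜 := ℝ) (x t) (((ξ t).comp K).comp P))).comp
          ((ξ t).comp K) ((ContinuousLinearMap.compL ℝ E E ℝ).flip P).hasFDerivAt
      have hL' : HasFDerivAt (fun z : E × (E →L[ℝ] ℝ) => H₀ z.1 z.2) L
          (x t, ((ξ t).comp K).comp P) := by rw [hξKP]; exact hL
      exact HasFDerivAt.comp (g := fun z : E × (E →L[ℝ] ℝ) => H₀ z.1 z.2)
        (f := fun η : E →L[ℝ] ℝ => (x t, η.comp P)) _ hL' e2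
    rw [h1.fderiv]
    have h2 := a.hasFDerivAt.comp_hasDerivWithinAt t (hψd.comp_hasDerivWithinAt t hx)
    refine h2.congr_deriv ?_
    simp [hLv]
  · have h1 : HasFDerivAt (fun y => H₁ y ((ξ t).comp K))
        (L.comp (K.prod (((ContinuousLinearMap.compL ℝ E E ℝ) ((ξ t).comp K)).comp
          (P2.comp K)))) (ψ (x t)) := by
      have e2 : HasFDerivAt (fun y => (κ y, ((ξ t).comp K).comp (fderiv ℝ ψ (κ y))))
          (K.prod (((ContinuousLinearMap.compL ℝ E E ℝ) ((ξ t).comp K)).comp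
          (P2.comp K))) (ψ (x t)) :=
        hκd.prodMk (((ContinuousLinearMap.compL ℝ E E ℝ) ((ξ t).comp K)).hasFDerivAt.comp _ hψ2')
      have hL' : HasFDerivAt (fun z : E × (E →L[ℝ] ℝ) => H₀ z.1 z.2) L
          (κ (ψ (x t)), ((ξ t).comp K).comp (fderiv ℝ ψ (κ (ψ (x t))))) := by
        rw [hxt, ← hP, hξKP]; exact hL
      exact (HasFDerivAt.comp (g := fun z : E × (E →L[ℝ] ℝ) => H₀ z.1 z.2)
        (f := fun y => (κ y, ((ξ t).comp K).comp (fderiv ℝ ψ (κ y)))) _ hL' e2).congr_of_eventuallyEq (hH.mono fun y hy => hy _)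
    rw [h1.fderiv]
    have h2 : HasDerivWithinAt (fun s => fderiv ℝ κ (ψ (x s))) (K2 (P v)) I t :=
      hκ2.hasFDerivAt.comp_hasDerivWithinAt t (hψd.comp_hasDerivWithinAt t hx)
    have h3 := hξ.clm_apply (h2.clm_apply (hasDerivWithinAt_const t I u))
    refine h3.congr_deriv ?_
    have e1 : L (K u, ((ξ t).comp K).comp (P2 (K u))) = -α (K u) + ξ t (K (P2 (K u) v)) := by
      have : (K u, ((ξ t).comp K).comp (P2 (K u))) =
          (K u, 0) + (0, ((ξ t).comp K).comp (P2 (K u))) := by simp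
      rw [this, map_add, hLα, hLv]
      simp
    -- The second derivative of κ, from differentiating the new momentum, cancels that of ψ, from
    -- the dependence of H₁ on position. Symmetry of the second derivative of κ puts its arguments
    -- in matching order.
    have e2 := hrel u (P v)
    rw [hKP] at e2
    have e3 := congrArg (fun w => ξ t (K w)) e2
    simp only [map_add, map_zero, hKP, hsymm u] at e3
    have e4 : L ((K.prod (((ContinuousLinearMap.compL ℝ E E ℝ) ((ξ t).comp K)).comp
          (P2.comp K))) u) = L (K u, ((ξ t).comp K).comp (P2 (K u))) := rfl
    rw [ContinuousLinearMap.comp_apply, e4, e1]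
    simp only [map_zero, add_zero]
    linarith

end ChangeOfCoordinates

/-! ### Solutions in one chart are normal extremals -/

section Transition

variable {n : ℕ} {M : Type*} [TopologicalSpace M] [ChartedSpace (ContactModel n) M]

local notation "φ" => extChartAt (𝓡 (2 * n + 1))

theorem eventually_mem_transition {c c' : M} {x : ContactModel n} (hx : x ∈ (φ c).target)
    (hx' : (φ c).symm x ∈ (φ c').source) :
    ∀ᶠ y in 𝓝 x, y ∈ (φ c).target ∧ (φ c).symm y ∈ (φ c').source :=
  ((isOpen_extChartAt_target c).eventually_mem hx).and
    ((continuousAt_extChartAt_symm'' hx).eventually_mem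
      ((isOpen_extChartAt_source c').mem_nhds hx'))

theorem eventually_transition_transition {c c' : M} {x : ContactModel n}
    (hx : x ∈ (φ c).target) (hx' : (φ c).symm x ∈ (φ c').source) :
    ∀ᶠ y in 𝓝 x, (φ c ∘ (φ c').symm) ((φ c' ∘ (φ c).symm) y) = y := by
  filter_upwards [eventually_mem_transition hx hx'] with y hy
  simp only [Function.comp_apply]
  rw [(φ c').left_inv hy.2, (φ c).right_inv hy.1]

variable [IsManifold (𝓡 (2 * n + 1)) ∞ M]

theorem contDiffAt_transition {c c' : M} {x : ContactModel n} (hx : x ∈ (φ c).target)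
    (hx' : (φ c).symm x ∈ (φ c').source) : ContDiffAt ℝ ∞ (φ c' ∘ (φ c).symm) x := by
  rw [← contMDiffAt_iff_contDiffAt]
  refine ContMDiffAt.comp x ?_
    ((contMDiffOn_extChartAt_symm c).contMDiffAt ((isOpen_extChartAt_target c).mem_nhds hx))
  exact contMDiffAt_extChartAt' (by simpa using hx')

theorem fderiv_transition {c c' : M} {x : ContactModel n} (hx : x ∈ (φ c).target)
    (hx' : (φ c).symm x ∈ (φ c').source) : fderiv ℝ (φ c' ∘ (φ c).symm) x =
      (chartDeriv c' ((φ c).symm x)).comp (chartSymmDeriv c x) :=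
  (hasFDerivAt_transition hx hx').fderiv

end Transition

namespace ContactSubRiemannian

variable {n : ℕ} {M : Type*} [TopologicalSpace M] [ChartedSpace (ContactModel n) M]
  [IsManifold (𝓡 (2 * n + 1)) ∞ M]

local notation "φ" => extChartAt (𝓡 (2 * n + 1))

/-- The Hamiltonian at `q`, for a covector given as a linear form on the model space. -/
noncomputable def hamiltonianAt (S : ContactSubRiemannian n M) (q : M)
    (ξ : ContactModel n →L[ℝ] ℝ) : ℝ :=
  S.hamiltonian q ξ

/-- The Hamiltonians in two charts are related by the change of canonical coordinates. -/
theorem hamiltonianInChart_transition (S : ContactSubRiemannian n M) {c c' : M}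
    {y : ContactModel n} (hy : y ∈ (φ c).target) (hy' : (φ c).symm y ∈ (φ c').source)
    (η : ContactModel n →L[ℝ] ℝ) :
    S.hamiltonianInChart c y η = S.hamiltonianInChart c' ((φ c' ∘ (φ c).symm) y)
      (η.comp (fderiv ℝ (φ c ∘ (φ c').symm) ((φ c' ∘ (φ c).symm) y))) := by
  have h1 : (φ c').symm ((φ c' ∘ (φ c).symm) y) = (φ c).symm y := (φ c').left_inv hy'
  have h2 : (φ c' ∘ (φ c).symm) y ∈ (φ c').target := (φ c').map_source hy'
  have h3 : (φ c').symm ((φ c' ∘ (φ c).symm) y) ∈ (φ c).source := by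
    rw [h1]; exact (φ c).map_target hy
  rw [fderiv_transition h2 h3]
  have h4 := chartSymmDeriv_comp_chartDeriv h2
  change S.hamiltonianAt _ (η.comp (chartDeriv c ((φ c).symm y))) = S.hamiltonianAt _
    ((η.comp ((chartDeriv c ((φ c').symm _)).comp (chartSymmDeriv c' _))).comp
      (chartDeriv c' ((φ c').symm _)))
  rw [ContinuousLinearMap.comp_assoc, ContinuousLinearMap.comp_assoc, h4,
    ContinuousLinearMap.comp_id]
  exact congrArg (fun q => S.hamiltonianAt q (η.comp (chartDeriv c q))) h1.symm

/-- The curve in `T*M` with canonical coordinates `z` in the chart around `c`. -/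
noncomputable def liftCurve (c : M) (z : ℝ → ContactModel n × (ContactModel n →L[ℝ] ℝ))
    (s : ℝ) : CotBundle n M :=
  ⟨(φ c).symm (z s).1, covectorOfChart c (z s).1 (z s).2⟩

/-- A solution of Hamilton's equations in one chart is a normal extremal. -/
theorem isNormalExtremal_liftCurve (S : ContactSubRiemannian n M) {q₀ : M}
    {B : ContactModel n → (ContactModel n →L[ℝ] ℝ) →L[ℝ] ContactModel n}
    {θ : ContactModel n → ContactModel n →L[ℝ] ℝ} {Ω : Set (ContactModel n)}
    {x₀ : ContactModel n} (h : IsContactCometric B θ Ω x₀) (hΩ : Ω ⊆ (φ q₀).target)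
    (hH : ∀ x ∈ Ω, ∀ ξ, S.hamiltonianInChart q₀ x ξ = 1 / 2 * ξ (B x ξ)) {T : ℝ}
    {z : ℝ → ContactModel n × (ContactModel n →L[ℝ] ℝ)}
    (hz : ∀ s ∈ Icc 0 T, (z s).1 ∈ Ω ∧ HasDerivAt z (cometricField B (z s)) s) :
    S.IsNormalExtremal T (liftCurve q₀ z) := by
  have hzc : ∀ s ∈ Icc 0 T, ContinuousAt (fun s => (z s).1) s := fun s hs =>
    (hz s hs).2.continuousAt.fst
  refine ⟨fun s hs => ?_, fun c t ht hsrc => ?_⟩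
  · exact ((continuousAt_extChartAt_symm'' (hΩ (hz s hs).1)).comp
      (f := fun s => (z s).1) (hzc s hs)).continuousWithinAt
  have hsrc' : (φ q₀).symm (z t).1 ∈ (φ c).source := hsrc
  have htg := hΩ (hz t ht).1
  have hyt : (φ c ∘ (φ q₀).symm) (z t).1 ∈ (φ c).target := (φ c).map_source hsrc'
  have hys : (φ c).symm ((φ c ∘ (φ q₀).symm) (z t).1) ∈ (φ q₀).source := by
    rw [Function.comp_apply, (φ c).left_inv hsrc']
    exact (φ q₀).map_target htg
  obtain ⟨L, hL, hLv, hLα⟩ := h.hasFDerivAt_hamiltonian hH (hz t ht).1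
  have hz1 : HasDerivAt (fun s => (z s).1) (cometricField B (z t)).1 t := (hz t ht).2.fst
  have hz2 : HasDerivAt (fun s => (z s).2) (cometricField B (z t)).2 t := (hz t ht).2.snd
  have key := hamilton_change_coordinates (H₀ := S.hamiltonianInChart q₀)
    (H₁ := S.hamiltonianInChart c) (ψ := φ c ∘ (φ q₀).symm) (κ := φ q₀ ∘ (φ c).symm)
    (x := fun s => (z s).1) (ξ := fun s => (z s).2) (I := Icc 0 T) (t := t)
    ((contDiffAt_transition htg hsrc').of_le (by norm_cast))
    ((contDiffAt_transition hyt hys).of_le (by norm_cast))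
    (eventually_transition_transition hyt hys) (eventually_transition_transition htg hsrc')
    ((eventually_mem_transition hyt hys).mono fun y hy η =>
      S.hamiltonianInChart_transition hy.1 hy.2 η)
    hL hLv hLα hz1.hasDerivWithinAt hz2.hasDerivWithinAt
  have hcov : ∀ s, (z s).1 ∈ (φ q₀).target → (φ q₀).symm (z s).1 ∈ (φ c).source →
      covectorInChart c (liftCurve q₀ z s).proj (liftCurve q₀ z s).snd =
        (z s).2.comp (fderiv ℝ (φ q₀ ∘ (φ c).symm) ((φ c ∘ (φ q₀).symm) (z s).1)) := by
    intro s h1 h2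
    have h3 : (φ c).symm ((φ c ∘ (φ q₀).symm) (z s).1) = (φ q₀).symm (z s).1 := (φ c).left_inv h2
    have h4 : (φ c).symm ((φ c ∘ (φ q₀).symm) (z s).1) ∈ (φ q₀).source := by
      rw [h3]; exact (φ q₀).map_target h1
    rw [fderiv_transition (x := (φ c ∘ (φ q₀).symm) (z s).1) ((φ c).map_source h2) h4, h3]
    rfl
  have hev : ∀ᶠ s in 𝓝 t, (z s).1 ∈ (φ q₀).target ∧ (φ q₀).symm (z s).1 ∈ (φ c).source :=
    (hzc t ht).eventually (eventually_mem_transition htg hsrc')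
  refine ⟨fun a => ?_, fun u => ?_⟩
  · have h1 := key.1 a
    rw [← hcov t htg hsrc'] at h1
    exact h1
  · have h1 := key.2 u
    rw [← hcov t htg hsrc'] at h1
    refine h1.congr_of_eventuallyEq ?_ ?_
    · filter_upwards [hev.filter_mono nhdsWithin_le_nhds] with s hs
      exact DFunLike.congr_fun (hcov s hs.1 hs.2) u
    · exact DFunLike.congr_fun (hcov t htg hsrc') u

end ContactSubRiemannian

/-! ### Uniqueness of normal extremals -/

section WeakDerivative

variable {E : Type*} [NormedAddCommGroup E] [NormedSpace ℝ E] [FiniteDimensional ℝ E]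

/-- Normal extremals satisfy Hamilton's equations tested on forms and vectors; finitely many tests
recover the vector equation to which ODE uniqueness applies. -/
theorem hasDerivWithinAt_of_forall_dual {f : ℝ → E} {f' : E} {I : Set ℝ} {t : ℝ}
    (h : ∀ a : E →L[ℝ] ℝ, HasDerivWithinAt (fun s => a (f s)) (a f') I t) :
    HasDerivWithinAt f f' I t := by
  let b := Module.finBasis ℝ E
  have h1 : HasDerivWithinAt (fun s => ∑ i, (b.coord i).toContinuousLinearMap (f s) • b i)
      (∑ i, (b.coord i).toContinuousLinearMap f' • b i) I t :=
    HasDerivWithinAt.fun_sum fun i _ => (h _).smul_const (b i)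
  have h2 : ∀ v, ∑ i, (b.coord i).toContinuousLinearMap v • b i = v := fun v => b.sum_repr v
  simpa only [h2] using h1

theorem hasDerivWithinAt_dual_of_forall {ξ : ℝ → E →L[ℝ] ℝ} {α : E →L[ℝ] ℝ} {I : Set ℝ} {t : ℝ}
    (h : ∀ u : E, HasDerivWithinAt (fun s => ξ s u) (α u) I t) : HasDerivWithinAt ξ α I t := by
  let b := Module.finBasis ℝ E
  have h1 : HasDerivWithinAt (fun s => ∑ i, ξ s (b i) • (b.coord i).toContinuousLinearMap)
      (∑ i, α (b i) • (b.coord i).toContinuousLinearMap) I t :=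
    HasDerivWithinAt.fun_sum fun i _ => (h _).smul_const _
  have h2 : ∀ η : E →L[ℝ] ℝ, ∑ i, η (b i) • (b.coord i).toContinuousLinearMap = η := fun η => by
    ext v
    conv_rhs => rw [← b.sum_repr v, map_sum]
    simp [mul_comm]
  simpa only [h2] using h1

end WeakDerivative

section Partial

variable {E F G : Type*} [NormedAddCommGroup E] [NormedSpace ℝ E] [NormedAddCommGroup F]
  [NormedSpace ℝ F] [NormedAddCommGroup G] [NormedSpace ℝ G] {H : E → F → G} {L : E × F →L[ℝ] G}
  {z : E × F}

theorem fderiv_partial_right (hL : HasFDerivAt (fun z : E × F => H z.1 z.2) L z) (a : F) :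
    fderiv ℝ (fun η => H z.1 η) z.2 a = L (0, a) := by
  have h := HasFDerivAt.comp (g := fun z : E × F => H z.1 z.2) (f := fun η => (z.1, η)) z.2 hL
    (hasFDerivAt_prodMk_right z.1 z.2)
  exact (DFunLike.congr_fun h.fderiv a).trans (by simp)

theorem fderiv_partial_left (hL : HasFDerivAt (fun z : E × F => H z.1 z.2) L z) (u : E) :
    fderiv ℝ (fun y => H y z.2) z.1 u = L (u, 0) := by
  have h := HasFDerivAt.comp (g := fun z : E × F => H z.1 z.2) (f := fun y => (y, z.2)) z.1 hL
    (hasFDerivAt_prodMk_left z.1 z.2)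
  exact (DFunLike.congr_fun h.fderiv u).trans (by simp)

end Partial

namespace ContactSubRiemannian

variable {n : ℕ} {M : Type*} [TopologicalSpace M] [ChartedSpace (ContactModel n) M]
  [IsManifold (𝓡 (2 * n + 1)) ∞ M]

local notation "φ" => extChartAt (𝓡 (2 * n + 1))

/-- The canonical coordinates of a point of `T*M` in the chart around `c`. -/
noncomputable def coordInChart (c : M) (w : CotBundle n M) :
    ContactModel n × (ContactModel n →L[ℝ] ℝ) :=
  (φ c w.proj, covectorInChart c w.proj w.snd)

/-- A normal extremal solves Hamilton's equations in the chart. -/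
theorem IsNormalExtremal.hasDerivWithinAt_coordInChart {S : ContactSubRiemannian n M} {q₀ : M}
    {B : ContactModel n → (ContactModel n →L[ℝ] ℝ) →L[ℝ] ContactModel n}
    {θ : ContactModel n → ContactModel n →L[ℝ] ℝ} {Ω : Set (ContactModel n)}
    {x₀ : ContactModel n} (h : IsContactCometric B θ Ω x₀)
    (hH : ∀ x ∈ Ω, ∀ ξ, S.hamiltonianInChart q₀ x ξ = 1 / 2 * ξ (B x ξ)) {T : ℝ}
    {w : ℝ → CotBundle n M} (hw : S.IsNormalExtremal T w) {t : ℝ} (ht : t ∈ Icc 0 T)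
    (hsrc : (w t).proj ∈ (φ q₀).source) (htΩ : φ q₀ (w t).proj ∈ Ω) :
    HasDerivWithinAt (fun s => coordInChart q₀ (w s))
      (cometricField B (coordInChart q₀ (w t))) (Icc 0 T) t := by
  obtain ⟨L, hL, hLv, hLα⟩ := h.hasFDerivAt_hamiltonian hH (z := coordInChart q₀ (w t)) htΩ
  obtain ⟨h1, h2⟩ := hw.2 q₀ t ht hsrc
  refine HasDerivWithinAt.prodMk (hasDerivWithinAt_of_forall_dual fun a => ?_)
    (hasDerivWithinAt_dual_of_forall fun u => ?_)
  · exact (h1 a).congr_deriv ((fderiv_partial_right hL a).trans (hLv a))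
  · refine (h2 u).congr_deriv ?_
    have h3 := fderiv_partial_left hL u
    rw [hLα] at h3
    exact neg_eq_iff_eq_neg.2 h3

/-- Uniqueness of normal extremals, as long as the solution stays in the chart. -/
theorem IsNormalExtremal.proj_eq [T2Space M] {S : ContactSubRiemannian n M} {q₀ : M}
    {B : ContactModel n → (ContactModel n →L[ℝ] ℝ) →L[ℝ] ContactModel n}
    {θ : ContactModel n → ContactModel n →L[ℝ] ℝ} {Ω : Set (ContactModel n)}
    {x₀ : ContactModel n} (h : IsContactCometric B θ Ω x₀) (hΩ : Ω ⊆ (φ q₀).target)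
    (hH : ∀ x ∈ Ω, ∀ ξ, S.hamiltonianInChart q₀ x ξ = 1 / 2 * ξ (B x ξ)) {T : ℝ}
    {w : ℝ → CotBundle n M} (hw : S.IsNormalExtremal T w)
    {z : ℝ → ContactModel n × (ContactModel n →L[ℝ] ℝ)}
    (hz : ∀ s ∈ Icc 0 T, (z s).1 ∈ Ω ∧ HasDerivAt z (cometricField B (z s)) s)
    (hw0 : (w 0).proj ∈ (φ q₀).source) (h0 : coordInChart q₀ (w 0) = z 0) :
    ∀ s ∈ Icc 0 T, (w s).proj = (φ q₀).symm (z s).1 := by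
  let y : ℝ → ContactModel n × (ContactModel n →L[ℝ] ℝ) := fun s => coordInChart q₀ (w s)
  -- Agreement is propagated along [0, T]: A contains 0, is closed in the interval, and extends to
  -- the right of each of its points.
  let A : Set ℝ := {s | (w s).proj ∈ (φ q₀).source ∧ y s = z s}
  have hzc : ∀ s ∈ Icc 0 T, ContinuousAt z s := fun s hs => (hz s hs).2.continuousAt
  have hproj : ∀ s ∈ A, (w s).proj = (φ q₀).symm (z s).1 := fun s hs => by
    rw [← hs.2]
    exact ((φ q₀).left_inv hs.1).symm
  have hAd : ∀ s ∈ A ∩ Icc 0 T, HasDerivWithinAt y (cometricField B (y s)) (Icc 0 T) s := by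
    intro s hs
    refine hw.hasDerivWithinAt_coordInChart h hH hs.2 hs.1.1 ?_
    have : φ q₀ (w s).proj = (z s).1 := congrArg Prod.fst hs.1.2
    rw [this]
    exact (hz s hs.2).1
  suffices hA : Icc 0 T ⊆ A from fun s hs => hproj s (hA hs)
  refine IsClosed.Icc_subset_of_forall_exists_gt ?_ ⟨hw0, h0⟩ ?_
  · refine isClosed_of_closure_subset fun s hs => ?_
    have hsI : s ∈ Icc 0 T := closure_minimal inter_subset_right isClosed_Icc hs
    have hne : (𝓝[A ∩ Icc 0 T] s).NeBot := mem_closure_iff_nhdsWithin_neBot.1 hs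
    have hle : 𝓝[A ∩ Icc 0 T] s ≤ 𝓝[Icc 0 T] s := nhdsWithin_mono _ inter_subset_right
    -- The extremal could a priori leave the chart in the limit. Limits in M being unique, its
    -- position is that of the chart solution, hence inside the chart.
    have hps : (w s).proj = (φ q₀).symm (z s).1 := by
      refine tendsto_nhds_unique_of_eventuallyEq (l := 𝓝[A ∩ Icc 0 T] s)
        ((hw.1 s hsI).mono_left hle)
        (((continuousAt_extChartAt_symm'' (hΩ (hz s hsI).1)).comp (f := fun s => (z s).1)
          (hzc s hsI).fst).tendsto.mono_left nhdsWithin_le_nhds) ?_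
      filter_upwards [self_mem_nhdsWithin] with r hr using hproj r hr.1
    have hsrc : (w s).proj ∈ (φ q₀).source := by
      rw [hps]
      exact (φ q₀).map_target (hΩ (hz s hsI).1)
    have hφ : φ q₀ (w s).proj = (z s).1 := by
      rw [hps]
      exact (φ q₀).right_inv (hΩ (hz s hsI).1)
    have hd := hw.hasDerivWithinAt_coordInChart h hH hsI hsrc (by rw [hφ]; exact (hz s hsI).1)
    refine ⟨⟨hsrc, ?_⟩, hsI⟩
    refine tendsto_nhds_unique_of_eventuallyEq (l := 𝓝[A ∩ Icc 0 T] s)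
      (hd.continuousWithinAt.mono_left hle) ((hzc s hsI).tendsto.mono_left nhdsWithin_le_nhds) ?_
    filter_upwards [self_mem_nhdsWithin] with r hr using hr.1.2
  · rintro s ⟨hsA, hsI⟩ b hb
    have hsI' : s ∈ Icc 0 T := Ico_subset_Icc_self hsI
    have hF : ContDiffAt ℝ 1 (cometricField B) (z s) :=
      (ContDiffAt.cometricField (h.contDiffAt (hz s hsI').1)).of_le (by norm_cast)
    -- The field is only locally Lipschitz, so r is chosen close enough to s that both curves stay
    -- in N on [s, r].
    obtain ⟨K, N, hN, hK⟩ := hF.exists_lipschitzOnWith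
    have e1 : ∀ᶠ r in 𝓝[Icc 0 T] s, z r ∈ N :=
      ((hzc s hsI').eventually_mem hN).filter_mono nhdsWithin_le_nhds
    have e2 : ∀ᶠ r in 𝓝[Icc 0 T] s, y r ∈ N := by
      have hc := (hAd s ⟨hsA, hsI'⟩).continuousWithinAt
      refine hc.eventually_mem ?_
      rw [hsA.2]
      exact hN
    have e3 : ∀ᶠ r in 𝓝[Icc 0 T] s, (w r).proj ∈ (φ q₀).source :=
      (hw.1 s hsI').eventually_mem ((isOpen_extChartAt_source q₀).mem_nhds hsA.1)
    have e4 : ∀ᶠ r in 𝓝[Icc 0 T] s, (y r).1 ∈ Ω := by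
      have hc := (hAd s ⟨hsA, hsI'⟩).continuousWithinAt
      refine hc.fst.eventually_mem (h.isOpen.mem_nhds ?_)
      have h1 := (hz s hsI').1
      rw [← hsA.2] at h1
      exact h1
    have e5 := (e1.and (e2.and (e3.and e4)))
    rw [eventually_nhdsWithin_iff, Metric.eventually_nhds_iff] at e5
    obtain ⟨δ, hδ, hδ'⟩ := e5
    let r := min b (min (s + δ / 2) T)
    have hsr : s < r := lt_min hb (lt_min (by linarith) hsI.2)
    have hrI : ∀ u ∈ Icc s r, u ∈ Icc 0 T := fun u hu =>
      ⟨hsI.1.trans hu.1, hu.2.trans ((min_le_right _ _).trans (min_le_right _ _))⟩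
    have hgood : ∀ u ∈ Icc s r, z u ∈ N ∧ y u ∈ N ∧ (w u).proj ∈ (φ q₀).source ∧
        (y u).1 ∈ Ω := by
      intro u hu
      refine hδ' ?_ (hrI u hu)
      have := hu.2.trans ((min_le_right _ _).trans (min_le_left _ _))
      rw [Real.dist_eq, abs_of_nonneg (by linarith [hu.1])]
      linarith
    have hyd : ∀ u ∈ Icc s r, HasDerivWithinAt y (cometricField B (y u)) (Icc 0 T) u :=
      fun u hu => hw.hasDerivWithinAt_coordInChart h hH (hrI u hu) (hgood u hu).2.2.1
        (hgood u hu).2.2.2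
    have heq := ODE_solution_unique_of_mem_Icc_right (v := fun _ => cometricField B)
      (s := fun _ => N) (fun _ _ => hK)
      (fun u hu => (hyd u hu).continuousWithinAt.mono fun u hu => hrI u hu)
      (fun u hu => (hyd u (Ico_subset_Icc_self hu)).mono_of_mem_nhdsWithin
        (Icc_mem_nhdsGE_of_mem ⟨(hrI u (Ico_subset_Icc_self hu)).1,
          hu.2.trans_le ((min_le_right _ _).trans (min_le_right _ _))⟩))
      (fun u hu => (hgood u (Ico_subset_Icc_self hu)).2.1)
      (fun u hu => (hzc u (hrI u hu)).continuousWithinAt)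
      (fun u hu => (hz u (hrI u (Ico_subset_Icc_self hu))).2.hasDerivWithinAt)
      (fun u hu => (hgood u (Ico_subset_Icc_self hu)).1) hsA.2
    have hrr : r ∈ Icc s r := right_mem_Icc.2 hsr.le
    exact ⟨r, ⟨(hgood r hrr).2.2.1, heq hrr⟩, hsr, min_le_left _ _⟩

end ContactSubRiemannian

/-! ### Homogeneity of the Hamiltonian and rescaling of extremals -/

/-- The chain rule for a homothety needs no differentiability, so the homogeneity identity can be
differentiated without any regularity of f. -/
theorem fderiv_smul_of_homogeneous {F : Type*} [NormedAddCommGroup F] [NormedSpace ℝ F]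
    {f : F → ℝ} {c : ℝ} (hc : c ≠ 0) (hf : ∀ x, f (c • x) = c ^ 2 * f x) (x : F) :
    fderiv ℝ f (c • x) = c • fderiv ℝ f x := by
  have h1 : fderiv ℝ (fun y => f (c • y)) x = c • fderiv ℝ f (c • x) := fderiv_comp_smul c
  have h2 : (fun y => f (c • y)) = c ^ 2 • f := funext hf
  rw [h2, fderiv_const_smul_field, Pi.smul_apply] at h1
  have h3 := congrArg (fun L => c⁻¹ • L) h1
  rw [inv_smul_smul₀ hc, smul_smul] at h3
  rw [← h3]
  congr 1
  field_simp

namespace ContactSubRiemannian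

variable {n : ℕ} {M : Type*} [TopologicalSpace M] [ChartedSpace (ContactModel n) M]
  [IsManifold (𝓡 (2 * n + 1)) ∞ M]

local notation "φ" => extChartAt (𝓡 (2 * n + 1))

theorem hamiltonian_smul (S : ContactSubRiemannian n M) (q : M) (c : ℝ) (p : CotSpace n q) :
    S.hamiltonian q (c • p) = c ^ 2 * S.hamiltonian q p := by
  unfold hamiltonian
  rw [mul_left_comm, Real.mul_iSup_of_nonneg (sq_nonneg c)]
  congr 2
  funext v
  change (c * p (v : S.Δ q)) ^ 2 / _ = _
  ring

theorem hamiltonianInChart_smul (S : ContactSubRiemannian n M) (q : M) (x : ContactModel n) (c : ℝ)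
    (ξ : ContactModel n →L[ℝ] ℝ) :
    S.hamiltonianInChart q x (c • ξ) = c ^ 2 * S.hamiltonianInChart q x ξ :=
  S.hamiltonian_smul _ c (covectorOfChart q x ξ)

/-- Normal extremals are invariant under the reparametrization `t ↦ c t`, `p ↦ c p`. -/
theorem IsNormalExtremal.rescale {S : ContactSubRiemannian n M} {T : ℝ} {w : ℝ → CotBundle n M}
    (hw : S.IsNormalExtremal T w) {c T' : ℝ} (hc : 0 < c) (hT : c * T' = T) :
    S.IsNormalExtremal T' (fun s => ⟨(w (c * s)).proj, c • (w (c * s)).snd⟩) := by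
  have hmaps : MapsTo (fun s => c * s) (Icc 0 T') (Icc 0 T) := fun s hs =>
    ⟨mul_nonneg hc.le hs.1, by rw [← hT]; exact mul_le_mul_of_nonneg_left hs.2 hc.le⟩
  refine ⟨hw.1.comp (by fun_prop) hmaps, fun q t ht hsrc => ?_⟩
  obtain ⟨h1, h2⟩ := hw.2 q (c * t) (hmaps ht) hsrc
  have hlin : HasDerivWithinAt (fun s : ℝ => c * s) c (Icc 0 T') t := by
    simpa using ((hasDerivAt_id t).const_mul c).hasDerivWithinAt
  refine ⟨fun a => ?_, fun u => ?_⟩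
  · have h3 := HasDerivWithinAt.scomp t (h1 a) hlin hmaps
    refine h3.congr_deriv ?_
    have h4 := fderiv_smul_of_homogeneous hc.ne' (S.hamiltonianInChart_smul q
      (φ q (w (c * t)).proj) c) (covectorInChart q (w (c * t)).proj (w (c * t)).snd)
    exact (DFunLike.congr_fun h4 a).symm
  · have h3 := (HasDerivWithinAt.scomp t (h2 u) hlin hmaps).const_mul c
    refine h3.congr_deriv ?_
    have h4 : (fun y => S.hamiltonianInChart q y
        (c • covectorInChart q (w (c * t)).proj (w (c * t)).snd)) = c ^ 2 • fun y =>
          S.hamiltonianInChart q y (covectorInChart q (w (c * t)).proj (w (c * t)).snd) :=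
      funext fun y => S.hamiltonianInChart_smul q y c _
    have h5 := congrArg (fun f => -(fderiv ℝ f (φ q (w (c * t)).proj) u)) h4
    refine Eq.trans ?_ h5.symm
    rw [fderiv_const_smul_field, Pi.smul_apply]
    exact (by intro a; ring : ∀ a : ℝ, c * (c * -a) = -(c ^ 2 * a)) _

theorem hamiltonian_eq_hamiltonianInChart (S : ContactSubRiemannian n M) {c q : M}
    (hq : q ∈ (φ c).source) (p : CotSpace n q) :
    S.hamiltonian q p = S.hamiltonianInChart c (φ c q) (covectorInChart c q p) := by
  have h1 := chartSymmDeriv_comp_chartDeriv ((φ c).map_source hq)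
  change S.hamiltonianAt q p = S.hamiltonianAt ((φ c).symm (φ c q))
    ((ContinuousLinearMap.comp (show ContactModel n →L[ℝ] ℝ from p)
      (chartSymmDeriv c (φ c q))).comp (chartDeriv c ((φ c).symm (φ c q))))
  rw [ContinuousLinearMap.comp_assoc, h1, (φ c).left_inv hq]
  rfl

theorem mk_covectorOfChart_covectorInChart {c q : M} (hq : q ∈ (φ c).source) (p : CotSpace n q) :
    (⟨(φ c).symm (φ c q), covectorOfChart c (φ c q) (covectorInChart c q p)⟩ : CotBundle n M) =
      ⟨q, p⟩ := by
  have h1 := chartSymmDeriv_comp_chartDeriv ((φ c).map_source hq)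
  have h2 : (ContinuousLinearMap.comp (show ContactModel n →L[ℝ] ℝ from p)
      (chartSymmDeriv c (φ c q))).comp (chartDeriv c ((φ c).symm (φ c q))) =
      (show ContactModel n →L[ℝ] ℝ from p) := by
    rw [ContinuousLinearMap.comp_assoc, h1]
    rfl
  have h3 : ∀ q' : M, q' = q → ∀ ξ : ContactModel n →L[ℝ] ℝ,
      ξ = (show ContactModel n →L[ℝ] ℝ from p) → (⟨q', ξ⟩ : CotBundle n M) = ⟨q, p⟩ := by
    rintro q' rfl ξ rfl
    rfl
  exact h3 _ ((φ c).left_inv hq) _ h2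

/-! ### The exponential map and its critical points near one covector -/

/-- A map to `M` which is a submersion in a chart is a submersion. -/
theorem surjective_mfderiv_of_chart {V : Type*} [NormedAddCommGroup V] [NormedSpace ℝ V] {c : M}
    {F : V → M} {G : V → ContactModel n} {D : V →L[ℝ] ContactModel n} {p : V}
    (hFG : F =ᶠ[𝓝 p] fun p' => (φ c).symm (G p')) (hG : HasFDerivAt G D p)
    (hp : G p ∈ (φ c).target) (hD : Function.Surjective D) :
    Function.Surjective (mfderiv 𝓘(ℝ, V) (𝓡 (2 * n + 1)) F p) := by
  have h1 := ((mdifferentiableAt_extChartAt_symm' hp).hasMFDerivAt.comp p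
    hG.hasMFDerivAt).congr_of_eventuallyEq hFG
  rw [h1.mfderiv]
  have h2 : Function.Surjective (chartSymmDeriv c (G p)) := fun v =>
    ⟨chartDeriv c ((φ c).symm (G p)) v, DFunLike.congr_fun (chartSymmDeriv_comp_chartDeriv hp) v⟩
  exact h2.comp hD

/-- The exponential is defined through a chosen extremal, so its value is determined once all
extremals from (q, p) end over the same point. -/
theorem exp_eq_of_forall (S : ContactSubRiemannian n M) {q x : M} {t : ℝ} {p : CotSpace n q}
    (hp : p ∈ S.expDomain q t)
    (h : ∀ w : ℝ → CotBundle n M, w 0 = ⟨q, p⟩ → S.IsNormalExtremal t w → (w t).proj = x) :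
    S.exp q t p = x := by
  unfold exp
  rw [dif_pos hp]
  exact h _ hp.choose_spec.1 hp.choose_spec.2

/-- The momentum coordinates of the covectors at `c` in the chart around `c`. -/
noncomputable def momentumAt (c : M) :
    (ContactModel n →L[ℝ] ℝ) →L[ℝ] (ContactModel n →L[ℝ] ℝ) :=
  (ContinuousLinearMap.compL ℝ (ContactModel n) (ContactModel n) ℝ).flip
    (chartSymmDeriv c (φ c c))

theorem momentumAt_apply (c : M) (p : ContactModel n →L[ℝ] ℝ) (v : ContactModel n) :
    momentumAt c p (chartDeriv c c v) = p v := by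
  have h1 := chartSymmDeriv_comp_chartDeriv ((φ c).map_source (mem_extChartAt_source c))
  rw [(φ c).left_inv (mem_extChartAt_source c)] at h1
  exact congrArg p (DFunLike.congr_fun h1 v)

theorem momentumAt_surjective (c : M) : Function.Surjective (momentumAt (n := n) c) := fun η =>
  ⟨η.comp (chartDeriv c ((φ c).symm (φ c c))), by
    change (η.comp _).comp _ = η
    rw [ContinuousLinearMap.comp_assoc, chartDeriv_comp_chartSymmDeriv
      ((φ c).map_source (mem_extChartAt_source c)), ContinuousLinearMap.comp_id]⟩

theorem hamiltonian_eq_momentumAt (S : ContactSubRiemannian n M) (q : M)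
    (p : ContactModel n →L[ℝ] ℝ) :
    S.hamiltonian q p = S.hamiltonianInChart q (φ q q) (momentumAt q p) :=
  S.hamiltonian_eq_hamiltonianInChart (mem_extChartAt_source q) p

/-- The exponential, also at time one of a rescaled covector, is computed by solving Hamilton's
equations in the chart at the initial point. -/
theorem exp_eq_extChartAt_symm [T2Space M] (S : ContactSubRiemannian n M) {q₀ : M}
    {B : ContactModel n → (ContactModel n →L[ℝ] ℝ) →L[ℝ] ContactModel n}
    {θ : ContactModel n → ContactModel n →L[ℝ] ℝ} {Ω : Set (ContactModel n)}
    {x₀ : ContactModel n} (h : IsContactCometric B θ Ω x₀) (hΩ : Ω ⊆ (φ q₀).target)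
    (hH : ∀ x ∈ Ω, ∀ ξ, S.hamiltonianInChart q₀ x ξ = 1 / 2 * ξ (B x ξ)) {t : ℝ} (ht : 0 < t)
    {p : CotSpace n q₀} {z : ℝ → ContactModel n × (ContactModel n →L[ℝ] ℝ)}
    (hz0 : z 0 = (φ q₀ q₀, covectorInChart q₀ q₀ p))
    (hz : ∀ s ∈ Icc 0 t, (z s).1 ∈ Ω ∧ HasDerivAt z (cometricField B (z s)) s) :
    S.exp q₀ t p = (φ q₀).symm (z t).1 ∧ S.exp q₀ 1 (t • p) = (φ q₀).symm (z t).1 := by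
  have hq₀ : q₀ ∈ (φ q₀).source := mem_extChartAt_source q₀
  have hext : S.IsNormalExtremal t (liftCurve q₀ z) := S.isNormalExtremal_liftCurve h hΩ hH hz
  have hext0 : liftCurve q₀ z 0 = ⟨q₀, p⟩ := by
    unfold liftCurve
    rw [hz0]
    exact mk_covectorOfChart_covectorInChart hq₀ p
  have huniq : ∀ w : ℝ → CotBundle n M, w 0 = ⟨q₀, p⟩ → S.IsNormalExtremal t w →
      (w t).proj = (φ q₀).symm (z t).1 := by
    intro w hw0 hw
    refine hw.proj_eq h hΩ hH hz (by rw [hw0]; exact hq₀) ?_ t (right_mem_Icc.2 ht.le)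
    rw [hw0, hz0]
    rfl
  refine ⟨S.exp_eq_of_forall ⟨_, hext0, hext⟩ huniq,
    S.exp_eq_of_forall ⟨_, ?_, hext.rescale ht (mul_one t)⟩ fun w hw0 hw1 => ?_⟩
  · rw [mul_zero, hext0]
  -- An extremal on [0, 1] from t • p, rescaled by 1/t, is an extremal on [0, t] from p, to which
  -- uniqueness applies.
  · have h1 := huniq _ ?_ (hw1.rescale (inv_pos.2 ht) (inv_mul_cancel₀ ht.ne'))
    · rwa [inv_mul_cancel₀ ht.ne'] at h1
    · rw [mul_zero, hw0]
      exact congrArg (fun p' : CotSpace n q₀ => (⟨q₀, p'⟩ : CotBundle n M))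
        (inv_smul_smul₀ ht.ne' p)

/-- Near a covector which does not vanish on the distribution, the exponential at small times is
given in a chart by a submersion. -/
theorem exists_exp_eq_extChartAt_symm [T2Space M] (S : ContactSubRiemannian n M) {q₀ : M}
    {p₀ : ContactModel n →L[ℝ] ℝ} (hp₀ : S.hamiltonian q₀ p₀ ≠ 0) :
    ∃ ε > 0, ∃ N : Set (ContactModel n →L[ℝ] ℝ), IsOpen N ∧ p₀ ∈ N ∧
      ∃ G : (ContactModel n →L[ℝ] ℝ) → ℝ → ContactModel n, ∀ p ∈ N, ∀ t ∈ Ioo (0 : ℝ) ε,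
        G p t ∈ (φ q₀).target ∧ S.exp q₀ t p = (φ q₀).symm (G p t) ∧
        S.exp q₀ 1 (t • p) = (φ q₀).symm (G p t) ∧
        ∃ D : (ContactModel n →L[ℝ] ℝ) →L[ℝ] ContactModel n,
          HasFDerivAt (fun p' => G p' t) D p ∧ Function.Surjective D := by
  obtain ⟨B, θ, Ω, h, hΩ, hH, -⟩ := S.exists_isContactCometric q₀
  have hBξ : B (φ q₀ q₀) (momentumAt q₀ p₀) ≠ 0 := by
    intro h0
    refine hp₀ ((S.hamiltonian_eq_momentumAt q₀ p₀).trans ((hH _ h.mem _).trans ?_))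
    rw [h0, map_zero, mul_zero]
  obtain ⟨r, hr, ε, hε, Z, hZ⟩ := h.exists_flow hBξ
  have hN : IsOpen (momentumAt q₀ ⁻¹' Metric.ball (momentumAt q₀ p₀) r) :=
    Metric.isOpen_ball.preimage (momentumAt q₀).continuous
  have hpN : p₀ ∈ momentumAt q₀ ⁻¹' Metric.ball (momentumAt q₀ p₀) r :=
    mem_preimage.2 (Metric.mem_ball_self hr)
  refine ⟨ε, hε, _, hN, hpN, fun p t => (Z (momentumAt q₀ p) t).1, fun p hp t ht => ?_⟩
  obtain ⟨h0, h1⟩ := hZ _ (mem_preimage.1 hp)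
  obtain ⟨hZΩ, -, D, hD, hDs⟩ := h1 t (Ioo_subset_Ico_self ht)
  have hexp := S.exp_eq_extChartAt_symm h hΩ hH ht.1 (p := p) h0 fun s hs =>
    have h2 := h1 s ⟨hs.1, hs.2.trans_lt ht.2⟩
    ⟨h2.1, h2.2.1⟩
  exact ⟨hΩ hZΩ, hexp.1, hexp.2, D.comp (momentumAt q₀),
    HasFDerivAt.comp (g := fun ξ => (Z ξ t).1) p hD (momentumAt q₀).hasFDerivAt,
    (hDs ht.1).comp (momentumAt_surjective q₀)⟩

/-- Near a covector which does not vanish on the distribution, the exponential at small times has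
no critical points, nor has the exponential at time one at small multiples. -/
theorem exists_nhds_not_isCriticalPoint [T2Space M] (S : ContactSubRiemannian n M) {q₀ : M}
    {p₀ : ContactModel n →L[ℝ] ℝ} (hp₀ : S.hamiltonian q₀ p₀ ≠ 0) :
    ∃ ε > 0, ∃ N ∈ 𝓝 p₀, ∀ p ∈ N, ∀ t ∈ Ioo 0 ε,
      ¬ S.IsCriticalPoint q₀ t p ∧ ¬ S.IsCriticalPoint q₀ 1 (t • p) := by
  obtain ⟨ε, hε, N, hN, hpN, G, hG⟩ := S.exists_exp_eq_extChartAt_symm hp₀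
  refine ⟨ε, hε, N, hN.mem_nhds hpN, fun p hp t ht => ?_⟩
  obtain ⟨hmem, -, -, D, hD, hDs⟩ := hG p hp t ht
  refine ⟨fun hcrit => hcrit.2 ?_, fun hcrit => hcrit.2 ?_⟩
  · refine surjective_mfderiv_of_chart (c := q₀) ?_ hD hmem hDs
    filter_upwards [hN.mem_nhds hp] with p' hp' using (hG p' hp' t ht).2.1
  -- Near t • p the time-one exponential is the time-t exponential precomposed with division by t,
  -- an invertible map.
  · have hscale : HasFDerivAt (fun p' : ContactModel n →L[ℝ] ℝ => t⁻¹ • p')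
        (t⁻¹ • ContinuousLinearMap.id ℝ (ContactModel n →L[ℝ] ℝ)) (t • p) :=
      (hasFDerivAt_id (t • p)).const_smul t⁻¹
    have hinv : t⁻¹ • t • p = p := inv_smul_smul₀ ht.1.ne' p
    have hG1 : HasFDerivAt (fun p' => G (t⁻¹ • p') t)
        (D.comp (t⁻¹ • ContinuousLinearMap.id ℝ (ContactModel n →L[ℝ] ℝ))) (t • p) := by
      refine HasFDerivAt.comp (g := fun p' => G p' t) (t • p) ?_ hscale
      rw [hinv]
      exact hD
    refine surjective_mfderiv_of_chart (c := q₀) ?_ hG1 (by rw [hinv]; exact hmem)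
      (hDs.comp fun η => ⟨t • η, inv_smul_smul₀ ht.1.ne' η⟩)
    have hN1 : ∀ᶠ p' in 𝓝 (t • p), t⁻¹ • p' ∈ N :=
      hscale.continuousAt.eventually_mem (hN.mem_nhds (by rw [hinv]; exact hp))
    filter_upwards [hN1] with p' hp'
    have h1 := (hG _ hp' t ht).2.2.1
    have h2 : t • t⁻¹ • p' = p' := smul_inv_smul₀ ht.1.ne' p'
    rwa [h2] at h1

end ContactSubRiemannian

/-! ### Compactness of the bounded part of the cylinder -/

namespace ContactSubRiemannian

variable {n : ℕ} {M : Type*} [TopologicalSpace M] [ChartedSpace (ContactModel n) M]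
  [IsManifold (𝓡 (2 * n + 1)) ∞ M]

local notation "φ" => extChartAt (𝓡 (2 * n + 1))

/-- The covectors on the unit cylinder `H = 1/2` with a bounded vertical component form a compact
set. -/
theorem isCompact_cylinder (S : ContactSubRiemannian n M) {q₀ : M} {X : ContactModel n}
    (hX : X ∉ S.Δ q₀) (b : ℝ) :
    IsCompact {p : ContactModel n →L[ℝ] ℝ | S.hamiltonian q₀ p = 1 / 2 ∧ |p X| ≤ b} := by
  obtain ⟨B, θ, Ω, h, -, hH, hΔ⟩ := S.exists_isContactCometric q₀
  have hθX : θ (φ q₀ q₀) (chartDeriv q₀ q₀ X) ≠ 0 := fun h0 => hX ((hΔ X).2 h0)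
  have hHp : ∀ p : ContactModel n →L[ℝ] ℝ, S.hamiltonian q₀ p =
      1 / 2 * momentumAt q₀ p (B (φ q₀ q₀) (momentumAt q₀ p)) := fun p =>
    (S.hamiltonian_eq_momentumAt q₀ p).trans (hH _ h.mem _)
  -- Injective because a covector killed by B is a multiple of θ, and θ does not vanish on X. In
  -- finite dimension L is then bounded below, so bounds on Bξ and p(X) bound p.
  let L : (ContactModel n →L[ℝ] ℝ) →ₗ[ℝ] ContactModel n × ℝ :=
    ((B (φ q₀ q₀)).comp (momentumAt q₀)).toLinearMap.prod
      (ContinuousLinearMap.apply ℝ ℝ X).toLinearMap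
  have hL : L.ker = ⊥ := by
    refine LinearMap.ker_eq_bot'.2 fun p hp => ?_
    obtain ⟨f, hf⟩ : ∃ f : ℝ, momentumAt q₀ p = f • θ (φ q₀ q₀) :=
      h.eq_smul _ h.mem _ (congrArg Prod.fst hp)
    have h1 : momentumAt q₀ p (chartDeriv q₀ q₀ X) = 0 :=
      (momentumAt_apply q₀ p X).trans (congrArg Prod.snd hp)
    rw [hf] at h1
    have hf0 : f = 0 := (mul_eq_zero.1 h1).resolve_right hθX
    rw [hf0, zero_smul] at hf
    ext v
    rw [← momentumAt_apply q₀ p v, hf]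
    rfl
  obtain ⟨K, -, hK⟩ := L.exists_antilipschitzWith hL
  have hbdd : Bornology.IsBounded
      {p : ContactModel n →L[ℝ] ℝ | S.hamiltonian q₀ p = 1 / 2 ∧ |p X| ≤ b} := by
    -- On the cylinder ξ(Bξ) = 2H = 1, hence ‖Bξ‖² ≤ ‖B‖.
    refine (hK.isBounded_preimage (Metric.isBounded_closedBall (x := (0 : ContactModel n × ℝ))
      (r := max √‖B (φ q₀ q₀)‖ b))).subset fun p hp => ?_
    have h2 : momentumAt q₀ p (B (φ q₀ q₀) (momentumAt q₀ p)) = 1 := by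
      linarith [(hHp p).symm.trans hp.1]
    have h3 := norm_sq_apply_le_of_symm_nonneg (h.symm _ h.mem) (h.nonneg _ h.mem) le_rfl
      (momentumAt q₀ p)
    rw [h2, mul_one] at h3
    rw [mem_preimage, mem_closedBall_zero_iff]
    exact max_le_max (Real.le_sqrt_of_sq_le h3) hp.2
  refine Metric.isCompact_of_isClosed_isBounded ?_ hbdd
  have hc1 : Continuous fun p : ContactModel n →L[ℝ] ℝ =>
      1 / 2 * momentumAt q₀ p (B (φ q₀ q₀) (momentumAt q₀ p)) :=
    continuous_const.mul ((momentumAt q₀).continuous.clm_apply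
      ((B (φ q₀ q₀)).continuous.comp (momentumAt q₀).continuous))
  have hc2 : Continuous fun p : ContactModel n →L[ℝ] ℝ => |p X| := by fun_prop
  have heq : {p : ContactModel n →L[ℝ] ℝ | S.hamiltonian q₀ p = 1 / 2 ∧ |p X| ≤ b} =
      {p | 1 / 2 * momentumAt q₀ p (B (φ q₀ q₀) (momentumAt q₀ p)) = 1 / 2} ∩ {p | |p X| ≤ b} := by
    ext p
    exact and_congr_left' (by rw [hHp]; exact Iff.rfl)
  rw [heq]
  exact (isClosed_eq hc1 continuous_const).inter (isClosed_le hc2 continuous_const)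

/-- On the part of the unit cylinder with a bounded vertical component, there are no conjugate
points for a uniformly positive time. -/
theorem exists_forall_not_isCriticalPoint [T2Space M] (S : ContactSubRiemannian n M) {q₀ : M}
    {X : ContactModel n} (hX : X ∉ S.Δ q₀) (b : ℝ) :
    ∃ ε > 0, ∀ p : ContactModel n →L[ℝ] ℝ, S.hamiltonian q₀ p = 1 / 2 → |p X| ≤ b →
      ∀ t ∈ Ioo 0 ε, ¬ S.IsCriticalPoint q₀ t p ∧ ¬ S.IsCriticalPoint q₀ 1 (t • p) := by
  have key : ∃ ε > 0, ∀ p ∈ {p : ContactModel n →L[ℝ] ℝ | S.hamiltonian q₀ p = 1 / 2 ∧ |p X| ≤ b},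
      ∀ t ∈ Ioo 0 ε, ¬ S.IsCriticalPoint q₀ t p ∧ ¬ S.IsCriticalPoint q₀ 1 (t • p) := by
    refine (S.isCompact_cylinder hX b).induction_on (p := fun s => ∃ ε : ℝ, ε > 0 ∧ ∀ p ∈ s,
      ∀ t ∈ Ioo 0 ε, ¬ S.IsCriticalPoint q₀ t p ∧ ¬ S.IsCriticalPoint q₀ 1 (t • p)) ?_ ?_ ?_ ?_
    · exact ⟨1, one_pos, fun p hp => hp.elim⟩
    · rintro s t hst ⟨ε, hε, h⟩
      exact ⟨ε, hε, fun p hp => h p (hst hp)⟩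
    · rintro s t ⟨ε, hε, h⟩ ⟨δ, hδ, h'⟩
      refine ⟨min ε δ, lt_min hε hδ, fun p hp τ hτ => ?_⟩
      rcases hp with hp | hp
      · exact h p hp τ ⟨hτ.1, hτ.2.trans_le (min_le_left _ _)⟩
      · exact h' p hp τ ⟨hτ.1, hτ.2.trans_le (min_le_right _ _)⟩
    · intro p hp
      have hp0 : S.hamiltonian q₀ p ≠ 0 := by
        intro h0
        have := h0.symm.trans hp.1
        norm_num at this
      obtain ⟨ε, hε, N, hN, h⟩ := S.exists_nhds_not_isCriticalPoint hp0
      exact ⟨N, mem_nhdsWithin_of_mem_nhds hN, ε, hε, h⟩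
  obtain ⟨ε, hε, h⟩ := key
  exact ⟨ε, hε, fun p h1 h2 => h p ⟨h1, h2⟩⟩

end ContactSubRiemannian

/-! ### The two estimates -/

theorem propositionL {n : ℕ} (hn : 1 ≤ n) {M : Type*} [TopologicalSpace M] [T2Space M]
    [ChartedSpace (ContactModel n) M] [IsManifold (𝓡 (2 * n + 1)) ∞ M]
    (S : ContactSubRiemannian n M) (q₀ : M)
    (X₀ : TangentSpace (𝓡 (2 * n + 1)) q₀) (hX₀ : X₀ ∉ S.Δ q₀) :
    (∀ hbar : ℝ, 0 < hbar → ∃ ε : ℝ, 0 < ε ∧ ∀ p : CotSpace n q₀,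
      S.hamiltonian q₀ p = 1 / 2 → S.firstConjugateTime q₀ p < (ε : EReal) → hbar < |p X₀|) ∧
    (∀ α : ℝ, 0 < α → ∃ R : ℝ, 0 < R ∧ ∀ p : CotSpace n q₀,
      0 < S.hamiltonian q₀ p → S.hamiltonian q₀ p < R → S.IsCriticalPoint q₀ 1 p →
        α * S.hamiltonian q₀ p < (p X₀) ^ 2) := by
  refine ⟨fun hbar _ => ?_, fun α hα => ?_⟩
  · obtain ⟨ε, hε, h⟩ := S.exists_forall_not_isCriticalPoint hX₀ hbar
    refine ⟨ε, hε, fun p hp hlt => ?_⟩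
    -- An infimum below ε yields an actual conjugate time below ε, whether or not the infimum is
    -- attained.
    obtain ⟨_, ⟨t, ht, rfl⟩, htε⟩ := sInf_lt_iff.1 hlt
    by_contra hle
    exact (h p hp (not_lt.1 hle) t ⟨ht.1, EReal.coe_lt_coe_iff.1 htε⟩).1 ht.2
  -- With s = √(2H(p)), the covector p/s lies on the cylinder, and h₀(p)² ≤ αH(p) amounts to
  -- h₀(p/s)² ≤ α/2. The bound H < ε²/2 says s < ε.
  · obtain ⟨ε, hε, h⟩ := S.exists_forall_not_isCriticalPoint hX₀ √(α / 2)
    refine ⟨ε ^ 2 / 2, by positivity, fun p hp hpR hcrit => ?_⟩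
    by_contra hle
    have hs : 0 < √(2 * S.hamiltonian q₀ p) := Real.sqrt_pos.2 (by positivity)
    have hs2 : √(2 * S.hamiltonian q₀ p) ^ 2 = 2 * S.hamiltonian q₀ p :=
      Real.sq_sqrt (by positivity)
    set s := √(2 * S.hamiltonian q₀ p) with hs_def
    have hsε : s < ε := (Real.sqrt_lt' hε).2 (by linarith)
    have h1 : S.hamiltonian q₀ (s⁻¹ • p) = 1 / 2 := by
      rw [S.hamiltonian_smul, inv_pow, hs2]
      field_simp
    have h2 : |(s⁻¹ • p) X₀| ≤ √(α / 2) := by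
      refine Real.abs_le_sqrt ?_
      change (s⁻¹ * p X₀) ^ 2 ≤ _
      rw [mul_pow, inv_pow, hs2, inv_mul_le_iff₀ (by positivity)]
      linarith [not_lt.1 hle]
    refine (h (s⁻¹ • p) h1 h2 s ⟨hs, hsε⟩).2 ?_
    have h3 : s • s⁻¹ • p = p := smul_inv_smul₀ hs.ne' p
    exact h3.symm ▸ hcrit
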